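/- Let $(N(t):t\ge 0)$ be a Poisson process of rate $\lambda$ and let $\mathbf W(1),\mathbf W(2),\dots$ be i.i.d. random vectors with values in $[0,\infty)^d$, independent of $N$. Let $Q\in\mathbb R^{d\times d}$ have non-negative entries, row sums at most $1$ and zero diagonal, put $R=(I-Q)^T$, let $\mathbf r\in\mathbb R^d$, and define $$\mathbf J(t)=\sum_{k=1}^{N(t)}\mathbf W(k),\qquad \mathbf X(t)=\mathbf J(t)-R\mathbf r\,t .$$ For a path $\mathbf x$ and $\mathbf y_0\in\mathbb R^d$, a solution of the Skorokhod problem $d\mathbf Y=d\mathbf x+R\,d\mathbf L$, $\mathbf Y(0)=\mathbf y_0$, is a pair $(\mathbf Y,\mathbf L)$ with $\mathbf Y(t)=\mathbf y_0+\mathbf x(t)-\mathbf x(0)+R\mathbf L(t)\ge 0$, each $L_i$ non-decreasing and right-continuous with $L_i(0)=0$, and $\int Y_i\,dL_i=0$ for each $i$. The workload process $\mathbf Y(\cdot)$ of the network is the solution on $[0,\infty)$ with input $\mathbf X$ and with $\mathbf Y(0)$ independent of $\mathbf X$. Assume (inequalities between vectors and matrices are componentwise): (A1) $R$ is invertible and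 $R^{-1}\ge 0$; (A2) $R^{-1}E\mathbf X(1)<0$; (A3) there is $\theta\in\mathbb R^d$, $\theta>0$, with $E\exp(\theta^T\mathbf W(1))<\infty$. Let $\mathbf z$ be any vector with $E\mathbf X(1)<\mathbf z$ and $R^{-1}\mathbf z<0$ (for instance $\mathbf z=E\mathbf X(1)+\delta\mathbf 1$ with $0<\delta R^{-1}\mathbf 1<-R^{-1}E\mathbf X(1)$), and put $\mathbf Z(t)=\mathbf X(t)-\mathbf z t$ and $\mathbf M(t)=\max_{u\ge t}\mathbf Z(u)$ (componentwise). Consider the following algorithm. Step 1: take any time $\tau\ge 0$ with $\mathbf M(\tau)=\mathbf Z(\tau)$, and the path $(\mathbf Z(t):0\le t\le\tau)$. Step 2: put $\mathbf X^{\leftarrow}_{-\tau}(t)=-\mathbf Z(\tau-t)-\mathbf z\,(\tau-t)$ for $0\le t\le\tau$ and solve on $[0,\tau]$ the Skorokhod problem $d\mathbf Y_{-\tau}(t,\mathbf 0)=d\mathbf X^{\leftarrow}_{-\tau}(t)+R\,d\mathbf L_{-\tau}(t,\mathbf 0)$ started from $\mathbf Y_{-\tau}(0,\mathbf 0)=\mathbf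 0$. Step 3: output $\mathbf Y_{-\tau}(\tau,\mathbf 0)$. Then the algorithm is well defined and terminates with probability one: almost surely the maxima $\mathbf M(t)$, $t\ge 0$, are all attained, there is a finite $\tau\ge 0$ with $\mathbf M(\tau)=\mathbf Z(\tau)$, and for every such $\tau$ the output of Steps 2 and 3 exists and is unique. Moreover its output is an exact sample from the distribution of $\mathbf Y(\infty)$: there is a probability measure $\pi$ on $\mathbb R^d$ which is the unique stationary distribution of the workload process, for every initial distribution on $[0,\infty)^d$ the workload process exists and $\mathbf Y(t)$ converges in distribution to $\pi$ as $t\to\infty$, and, whichever random time $\tau$ is taken in Step 1, the output $\mathbf Y_{-\tau}(\tau,\mathbf 0)$ has distribution $\pi$. -/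

import Mathlib

open MeasureTheory ProbabilityTheory Filter Set
open scoped NNReal ENNReal Matrix

noncomputable section

namespace ReflectedNetwork

/-- A Poisson process of rate `lam` on `[0, ∞)`: it starts at `0`, its paths are non-decreasing,
right-continuous and `ℕ`-valued, its increments are independent, and the increment over `[s, t]`
is Poisson with mean `lam * (t - s)`. -/
structure IsPoissonProcess {Ω : Type*} [MeasurableSpace Ω] (lam : ℝ≥0) (N : ℝ≥0 → Ω → ℕ)
    (P : Measure Ω) : Prop where
  measurable : ∀ t, Measurable (N t)
  zero : ∀ ω, N 0 ω = 0
  mono : ∀ ω, Monotone (fun t => N t ω)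
  rightCont : ∀ ω t, ContinuousWithinAt (fun s => N s ω) (Ici t) t
  indepIncrements : HasIndepIncrements N P
  law_increment : ∀ s t : ℝ≥0, s ≤ t →
    HasLaw (fun ω => N t ω - N s ω) (poissonMeasure (lam * (t - s))) P

/-- The job requirements: `W k` is the requirement vector of arrival number `k + 1`. The vectors
are i.i.d. and non-negative (the coordinates of one vector may be dependent). -/
structure IsJobSequence {Ω : Type*} [MeasurableSpace Ω] {d : ℕ} (W : ℕ → Ω → (Fin d → ℝ))
    (P : Measure Ω) : Prop where
  measurable : ∀ k, Measurable (W k)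
  indep : iIndepFun W P
  identDistrib : ∀ k, IdentDistrib (W k) (W 0) P P
  nonneg : ∀ k, ∀ᵐ ω ∂P, 0 ≤ W k ω

/-- A routing matrix: non-negative entries, row sums at most `1`, zero diagonal. -/
structure IsRoutingMatrix {d : ℕ} (Q : Matrix (Fin d) (Fin d) ℝ) : Prop where
  nonneg : ∀ i j, 0 ≤ Q i j
  row_sum_le : ∀ i, ∑ j, Q i j ≤ 1
  diag : ∀ i, Q i i = 0

/-- The reflection matrix `R = (I - Q)ᵀ`. -/
def reflMatrix {d : ℕ} (Q : Matrix (Fin d) (Fin d) ℝ) : Matrix (Fin d) (Fin d) ℝ := (1 - Q)ᵀ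

/-- Work arrived by time `t`: `J(t) = ∑_{k ≤ N(t)} W(k)`. -/
def arrivedWork {Ω : Type*} {d : ℕ} (N : ℝ≥0 → Ω → ℕ) (W : ℕ → Ω → (Fin d → ℝ))
    (t : ℝ≥0) (ω : Ω) : Fin d → ℝ :=
  ∑ k ∈ Finset.range (N t ω), W k ω

/-- The net input process `X(t) = J(t) - R r t`. -/
def netInput {Ω : Type*} {d : ℕ} (N : ℝ≥0 → Ω → ℕ) (W : ℕ → Ω → (Fin d → ℝ))
    (Q : Matrix (Fin d) (Fin d) ℝ) (r : Fin d → ℝ) (t : ℝ≥0) (ω : Ω) : Fin d → ℝ :=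
  arrivedWork N W t ω - (t : ℝ) • (reflMatrix Q *ᵥ r)

/-- The mean vector `E X(1)`. -/
def meanInput {Ω : Type*} [MeasurableSpace Ω] {d : ℕ} (P : Measure Ω) (N : ℝ≥0 → Ω → ℕ)
    (W : ℕ → Ω → (Fin d → ℝ)) (Q : Matrix (Fin d) (Fin d) ℝ) (r : Fin d → ℝ) : Fin d → ℝ :=
  fun i => ∫ ω, netInput N W Q r 1 ω i ∂P

/-- The process `Z(t) = X(t) - z t` that drives the orthogonally reflected dominating process. -/
def dominatingInput {Ω : Type*} {d : ℕ} (N : ℝ≥0 → Ω → ℕ) (W : ℕ → Ω → (Fin d → ℝ))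
    (Q : Matrix (Fin d) (Fin d) ℝ) (r z : Fin d → ℝ) (t : ℝ≥0) (ω : Ω) : Fin d → ℝ :=
  netInput N W Q r t ω - (t : ℝ) • z

/-- `(Y, L)` solves, on the time interval `[0, T]`, the Skorokhod problem
`dY = dx + R dL`, `Y(0) = y₀`: one has `Y(t) = y₀ + x(t) - x(0) + R L(t)` with `Y ≥ 0`, every `Lᵢ`
is non-decreasing and right-continuous with `Lᵢ(0) = 0`, and `∫_{[0,T]} Yᵢ dLᵢ = 0`.
Monotonicity and right-continuity are part of the type `StieltjesFunction`; the Stieltjes measure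
on `ℝ≥0` gives no mass to the time `0`; the values of `L` after time `T` play no role. -/
structure IsSkorokhodSolution {d : ℕ} (R : Matrix (Fin d) (Fin d) ℝ) (x : ℝ≥0 → (Fin d → ℝ))
    (y₀ : Fin d → ℝ) (T : ℝ≥0) (Y : ℝ≥0 → (Fin d → ℝ)) (L : Fin d → StieltjesFunction ℝ≥0) :
    Prop where
  eqn : ∀ t ≤ T, Y t = y₀ + (x t - x 0) + R *ᵥ (fun i => L i t)
  nonneg : ∀ t ≤ T, 0 ≤ Y t
  reg_zero : ∀ i, L i 0 = 0
  compl : ∀ i, ∫⁻ s in Iic T, ENNReal.ofReal (Y s i) ∂(L i).measure = 0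

/-- `Y` is a workload process of the network with initial law `ν`. It lives on the product space,
so that the initial state (the second coordinate) has law `ν` and is independent of the input
`X` (a function of the first coordinate), and almost every path solves the Skorokhod problem on all
of `[0, ∞)`. -/
def IsWorkload {Ω : Type*} [MeasurableSpace Ω] {d : ℕ} (P : Measure Ω)
    (R : Matrix (Fin d) (Fin d) ℝ) (X : ℝ≥0 → Ω → (Fin d → ℝ)) (ν : Measure (Fin d → ℝ))
    (Y : ℝ≥0 → Ω × (Fin d → ℝ) → (Fin d → ℝ)) : Prop :=
  ∀ᵐ p ∂(P.prod ν), ∃ L : Fin d → StieltjesFunction ℝ≥0,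
    ∀ T, IsSkorokhodSolution R (fun t => X t p.1) p.2 T (fun t => Y t p) L

/-- `ν` is a stationary distribution of the workload process: started from `ν`, independently of
the input, the workload has law `ν` at all times. -/
def IsStationaryLaw {Ω : Type*} [MeasurableSpace Ω] {d : ℕ} (P : Measure Ω)
    (R : Matrix (Fin d) (Fin d) ℝ) (X : ℝ≥0 → Ω → (Fin d → ℝ)) (ν : Measure (Fin d → ℝ)) : Prop :=
  ∃ Y : ℝ≥0 → Ω × (Fin d → ℝ) → (Fin d → ℝ),
    IsWorkload P R X ν Y ∧ ∀ t, HasLaw (Y t) ν (P.prod ν)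

/-- The future running maximum `M(t) = max_{u ≥ t} Z(u)`, componentwise, of a path. -/
def futureMax {d : ℕ} (Z : ℝ≥0 → (Fin d → ℝ)) (t : ℝ≥0) : Fin d → ℝ :=
  fun i => sSup ((fun u => Z u i) '' Ici t)

/-- The path `X←_{-τ}(t) = -Z(τ - t) - z (τ - t)`, meaningful for `0 ≤ t ≤ τ`. -/
def reversedInput {d : ℕ} (Z : ℝ≥0 → (Fin d → ℝ)) (z : Fin d → ℝ) (τ t : ℝ≥0) : Fin d → ℝ :=
  -Z (τ - t) - ((τ - t : ℝ≥0) : ℝ) • z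

/-- Steps 2 and 3 of the algorithm: `y` is the state at time `τ` of the solution started from `0` of
the Skorokhod problem on `[0, τ]` with input `X←_{-τ}`. -/
def IsOutput {d : ℕ} (R : Matrix (Fin d) (Fin d) ℝ) (Z : ℝ≥0 → (Fin d → ℝ)) (z : Fin d → ℝ)
    (τ : ℝ≥0) (y : Fin d → ℝ) : Prop :=
  ∃ (Y : ℝ≥0 → (Fin d → ℝ)) (L : Fin d → StieltjesFunction ℝ≥0),
    IsSkorokhodSolution R (reversedInput Z z τ) 0 τ Y L ∧ Y τ = y

end ReflectedNetwork

end

open ReflectedNetwork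

/-! The proof is coupling from the past. Reflecting `X` on `[0, t]` from a state `y` gives, at the
fixed time `t`, the same law as reflecting the reversed path `u ↦ -X(t - u)` from `y`, because `X`
has stationary independent increments (`identDistrib_rev`). The reversed reflections converge not
only in law but pathwise, by becoming constant.

Coalescence (`skState_revPath_eq_zero`, `skState_revPath_eq`) is a comparison argument. The
regulator of a Skorokhod solution is the least feasible one: the least non-decreasing non-negative
`L` with `v + R L ≥ 0`. This rests on `R⁻¹ ≥ 0`, through the implication `R δ ≤ 0 → δ ≤ 0`. Let `τ`
be a time from which on `Z` never exceeds `Z(τ)`. If `t` is so large that `y + Z(t) ≤ Z(τ)`, then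
the regulator `-u R⁻¹ z + R⁻¹ (Z(τ) - Z(t) - y)` is feasible for the reversed path and produces the
state `Z(τ) - Z(t - u)`, which vanishes at `u = t - τ`. By minimality the true reflection is also
empty there, and by the flow property it then follows the path that the algorithm computes. Hence
its state at time `t` equals the output for all large `t`, whatever `y` is, and the output does not
depend on which `τ` was taken.

Let `π` be the law of this eventual value. Convergence in law from every initial distribution is
immediate. Stationarity follows by letting `n → ∞` in the Markov property at times `n` and `n + T`,
and a stationary law, being a constant family converging to `π`, must be `π`.

A record time `τ` exists because `Z`, sampled at integer times, is a random walk with negative drift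
whose arrival part can pause: a long pause followed by a well-behaved walk has positive probability,
and a zero-one law makes this happen eventually (`ae_exists_forall_sum_le`).

Since the minimal regulator is an infimum over an uncountable family, measurability, equality in law
and independence are all proved on finite grids, where the reflection is a Lipschitz function of the
path, and passed to the limit (`tendsto_gridState`, `identDistrib_of_tendsto`). -/

namespace ReflectedNetwork

variable {d : ℕ} {Q : Matrix (Fin d) (Fin d) ℝ}

/-! ### Linear algebra of the reflection matrix -/

/-- A non-negative routing matrix whose reflection matrix has a non-negative inverse. -/
structure IsTransient (Q : Matrix (Fin d) (Fin d) ℝ) : Prop where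
  nonneg : ∀ i j, 0 ≤ Q i j
  isUnit : IsUnit (reflMatrix Q)
  inv_nonneg : ∀ i j, 0 ≤ (reflMatrix Q)⁻¹ i j

lemma reflMatrix_mulVec (Q : Matrix (Fin d) (Fin d) ℝ) (v : Fin d → ℝ) (i : Fin d) :
    (reflMatrix Q *ᵥ v) i = v i - (Qᵀ *ᵥ v) i := by
  simp [reflMatrix, Matrix.transpose_sub, Matrix.sub_mulVec]

lemma mulVec_mono_of_nonneg {A : Matrix (Fin d) (Fin d) ℝ} (hA : ∀ i j, 0 ≤ A i j)
    {u w : Fin d → ℝ} (h : u ≤ w) : A *ᵥ u ≤ A *ᵥ w := by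
  intro i
  simp only [Matrix.mulVec, dotProduct]
  exact Finset.sum_le_sum fun j _ => mul_le_mul_of_nonneg_left (h j) (hA i j)

namespace IsTransient

lemma transpose_mono (hQ : IsTransient Q) {u w : Fin d → ℝ} (h : u ≤ w) :
    Qᵀ *ᵥ u ≤ Qᵀ *ᵥ w :=
  mulVec_mono_of_nonneg (fun i j => hQ.nonneg j i) h

lemma inv_mono (hQ : IsTransient Q) {u w : Fin d → ℝ} (h : u ≤ w) :
    (reflMatrix Q)⁻¹ *ᵥ u ≤ (reflMatrix Q)⁻¹ *ᵥ w :=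
  mulVec_mono_of_nonneg hQ.inv_nonneg h

lemma inv_mulVec_nonneg (hQ : IsTransient Q) {u : Fin d → ℝ} (h : 0 ≤ u) :
    0 ≤ (reflMatrix Q)⁻¹ *ᵥ u := by
  simpa using hQ.inv_mono h

lemma inv_mulVec_mulVec (hQ : IsTransient Q) (u : Fin d → ℝ) :
    (reflMatrix Q)⁻¹ *ᵥ (reflMatrix Q *ᵥ u) = u := by
  rw [Matrix.mulVec_mulVec, Matrix.nonsing_inv_mul _ ((Matrix.isUnit_iff_isUnit_det _).1 hQ.isUnit),
    Matrix.one_mulVec]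

lemma mulVec_inv_mulVec (hQ : IsTransient Q) (u : Fin d → ℝ) :
    reflMatrix Q *ᵥ ((reflMatrix Q)⁻¹ *ᵥ u) = u := by
  rw [Matrix.mulVec_mulVec, Matrix.mul_nonsing_inv _ ((Matrix.isUnit_iff_isUnit_det _).1 hQ.isUnit),
    Matrix.one_mulVec]

lemma nonpos_of_mulVec_nonpos (hQ : IsTransient Q) {u : Fin d → ℝ}
    (h : reflMatrix Q *ᵥ u ≤ 0) : u ≤ 0 := by
  have := hQ.inv_mono h
  rwa [hQ.inv_mulVec_mulVec, Matrix.mulVec_zero] at this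

end IsTransient

/-! ### Regulators on a preordered time set -/

section Regulator

variable {α : Type*} [Preorder α] {S : Set α} {v w : α → Fin d → ℝ} {L L' : α → Fin d → ℝ}

/-- `L` is non-decreasing and non-negative on `S` and keeps `v + R L` non-negative. -/
structure IsFeasible (Q : Matrix (Fin d) (Fin d) ℝ) (S : Set α) (v L : α → Fin d → ℝ) : Prop where
  mono : MonotoneOn L S
  nonneg : ∀ t ∈ S, 0 ≤ L t
  state_nonneg : ∀ t ∈ S, 0 ≤ v t + reflMatrix Q *ᵥ L t

/-- `L` is a feasible regulator of the free path `v` on `S`, each coordinate of which is no larger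
than the one-dimensional reflection condition requires. -/
structure IsRegulator (Q : Matrix (Fin d) (Fin d) ℝ) (S : Set α) (v L : α → Fin d → ℝ) : Prop
    extends IsFeasible Q S v L where
  le_of_forall : ∀ t ∈ S, ∀ i, ∀ m : ℝ, 0 ≤ m →
    (∀ s ∈ S, s ≤ t → (Qᵀ *ᵥ L s) i - v s i ≤ m) → L t i ≤ m

lemma IsFeasible.sub_le (h : IsFeasible Q S v L) {t : α} (ht : t ∈ S) (i : Fin d) :
    (Qᵀ *ᵥ L t) i - v t i ≤ L t i := by
  have := h.state_nonneg t ht i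
  simp only [Pi.zero_apply, Pi.add_apply, reflMatrix_mulVec] at this
  linarith

lemma isFeasible_iff_of_mono (hm : MonotoneOn L S) (hn : ∀ t ∈ S, 0 ≤ L t)
    (h : ∀ t ∈ S, ∀ i, (Qᵀ *ᵥ L t) i - v t i ≤ L t i) : IsFeasible Q S v L := by
  refine ⟨hm, hn, fun t ht i => ?_⟩
  have := h t ht i
  simp only [Pi.zero_apply, Pi.add_apply, reflMatrix_mulVec]
  linarith

/-- Regulators are minimal among the feasible ones. -/
lemma IsRegulator.le_of_isFeasible (hQ : IsTransient Q) (h : IsRegulator Q S v L)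
    (h' : IsFeasible Q S v L') {t : α} (ht : t ∈ S) : L t ≤ L' t := by
  have hbdd : ∀ i, BddAbove ((fun s => max (L s i - L' s i) 0) '' {s ∈ S | s ≤ t}) := by
    intro i
    refine ⟨L t i, ?_⟩
    rintro _ ⟨s, ⟨hs, hst⟩, rfl⟩
    have h1 := h.mono hs ht hst i
    have h2 := h'.nonneg s hs i
    have h3 := h.nonneg t ht i
    simp only [Pi.zero_apply] at h2 h3
    exact max_le (by linarith) h3
  -- `δ` is the largest excess of `L` over `L'` up to time `t`. The excess of one coordinate can
  -- only come from the excess routed to it by the others, so `δ ≤ Qᵀ δ`, that is `R δ ≤ 0`, and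
  -- `R⁻¹ ≥ 0` forces `δ ≤ 0`.
  set δ : Fin d → ℝ := fun i => sSup ((fun s => max (L s i - L' s i) 0) '' {s ∈ S | s ≤ t})
  have hδ : ∀ s ∈ S, s ≤ t → ∀ i, max (L s i - L' s i) 0 ≤ δ i := fun s hs hst i =>
    le_csSup (hbdd i) ⟨s, ⟨hs, hst⟩, rfl⟩
  have hδ0 : 0 ≤ δ := fun i => (le_max_right _ _).trans (hδ t ht le_rfl i)
  have hQδ : 0 ≤ Qᵀ *ᵥ δ := by simpa using hQ.transpose_mono hδ0
  have key : ∀ s ∈ S, s ≤ t → ∀ i, L s i ≤ L' s i + (Qᵀ *ᵥ δ) i := by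
    intro s hs hst i
    have hL's := h'.nonneg s hs i
    have hQδi := hQδ i
    simp only [Pi.zero_apply] at hL's hQδi
    refine h.le_of_forall s hs i _ (by linarith) fun s' hs' hs's => ?_
    have h1 : L s' ≤ L' s' + δ := fun j => by
      have := (le_max_left _ _).trans (hδ s' hs' (hs's.trans hst) j)
      simp only [Pi.add_apply]; linarith
    have h2 := hQ.transpose_mono h1 i
    rw [Matrix.mulVec_add] at h2
    have h3 := h'.sub_le hs' i
    have h4 := h'.mono hs' hs hs's i
    simp only [Pi.add_apply] at h2
    linarith
  have hle : δ ≤ Qᵀ *ᵥ δ := fun i => by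
    refine csSup_le ⟨_, t, ⟨ht, le_rfl⟩, rfl⟩ ?_
    rintro _ ⟨s, ⟨hs, hst⟩, rfl⟩
    exact max_le (by linarith [key s hs hst i]) (hQδ i)
  have hδle : δ ≤ 0 := hQ.nonpos_of_mulVec_nonpos fun i => by
    rw [reflMatrix_mulVec]; simpa using hle i
  intro i
  have := ((le_max_left _ _).trans (hδ t ht le_rfl i)).trans (hδle i)
  simpa using this

lemma IsRegulator.eq (hQ : IsTransient Q) (h : IsRegulator Q S v L) (h' : IsRegulator Q S v L')
    {t : α} (ht : t ∈ S) : L t = L' t :=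
  le_antisymm (h.le_of_isFeasible hQ h'.toIsFeasible ht)
    (h'.le_of_isFeasible hQ h.toIsFeasible ht)

lemma IsRegulator.mono_set {S' : Set α} (h : IsRegulator Q S v L) (hS : S' ⊆ S)
    (hlow : ∀ t ∈ S', ∀ s ∈ S, s ≤ t → s ∈ S') : IsRegulator Q S' v L where
  mono := h.mono.mono hS
  nonneg t ht := h.nonneg t (hS ht)
  state_nonneg t ht := h.state_nonneg t (hS ht)
  le_of_forall t ht i m hm H := h.le_of_forall t (hS ht) i m hm fun s hs hst =>
    H s (hlow t ht s hs hst) hst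

/-- The pointwise infimum of all feasible regulators. -/
noncomputable def minReg (Q : Matrix (Fin d) (Fin d) ℝ) (S : Set α) (v : α → Fin d → ℝ) :
    α → Fin d → ℝ :=
  fun t i => sInf ((fun L : α → Fin d → ℝ => L t i) '' {L | IsFeasible Q S v L})

lemma minReg_le (h : IsFeasible Q S v L) {t : α} (ht : t ∈ S) : minReg Q S v t ≤ L t := by
  refine fun i => csInf_le ⟨0, ?_⟩ ⟨L, h, rfl⟩
  rintro _ ⟨L', hL', rfl⟩
  exact hL'.nonneg t ht i

lemma le_minReg (h : IsFeasible Q S v L) {t : α} {i : Fin d} {m : ℝ}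
    (hm : ∀ L', IsFeasible Q S v L' → m ≤ L' t i) : m ≤ minReg Q S v t i := by
  refine le_csInf ⟨_, L, h, rfl⟩ ?_
  rintro _ ⟨L', hL', rfl⟩
  exact hm L' hL'

/-- If there is a feasible regulator at all, the infimum of the feasible ones is a regulator. -/
lemma isRegulator_minReg (hQ : IsTransient Q) (h : IsFeasible Q S v L) :
    IsRegulator Q S v (minReg Q S v) := by
  have hF : IsFeasible Q S v (minReg Q S v) := by
    refine isFeasible_iff_of_mono (fun s hs t ht hst i => ?_) (fun t ht i => ?_) fun t ht i => ?_
    · exact le_minReg h fun L' hL' => (minReg_le hL' hs i).trans (hL'.mono hs ht hst i)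
    · exact le_minReg h fun L' hL' => hL'.nonneg t ht i
    · refine le_minReg h fun L' hL' => ?_
      have h1 := hL'.sub_le ht i
      have h2 := hQ.transpose_mono (minReg_le hL' ht) i
      linarith
  refine ⟨hF, fun t ht i m hm H => ?_⟩
  classical
  set M := minReg Q S v
  -- Capping coordinate `i` at `m` up to time `t` keeps feasibility: `m` covers what coordinate `i`
  -- needs there, and lowering it only lowers the needs of the others. Minimality then bounds the
  -- infimum itself by `m`.
  let L₁ : α → Fin d → ℝ := fun s j => if j = i ∧ s ≤ t then min (M s j) m else M s j
  have hle : ∀ s, L₁ s ≤ M s := fun s j => by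
    simp only [L₁]; split_ifs
    · exact min_le_left _ _
    · exact le_rfl
  have h1 : IsFeasible Q S v L₁ := by
    refine isFeasible_iff_of_mono (fun s hs u hu hsu j => ?_) (fun s hs j => ?_) fun s hs j => ?_
    · have hm' := hF.mono hs hu hsu j
      simp only [L₁]
      split_ifs with h1 h2 h2
      · exact min_le_min_right _ hm'
      · exact (min_le_left _ _).trans hm'
      · exact absurd ⟨h2.1, hsu.trans h2.2⟩ h1
      · exact hm'
    · have := hF.nonneg s hs j
      simp only [L₁]; split_ifs
      · exact le_min this hm
      · exact this
    · have h2 := hQ.transpose_mono (hle s) j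
      have h3 := hF.sub_le hs j
      simp only [L₁] at h2 ⊢
      split_ifs with hj
      · obtain ⟨rfl, hst⟩ := hj
        exact le_min (by linarith) (by linarith [H s hs hst])
      · linarith
  have h2 := minReg_le h1 ht i
  simp only [L₁, le_refl, and_self, if_true] at h2
  exact h2.trans (min_le_right _ _)

lemma IsRegulator.eq_minReg (hQ : IsTransient Q) (h : IsRegulator Q S v L) {t : α} (ht : t ∈ S) :
    L t = minReg Q S v t :=
  h.eq hQ (isRegulator_minReg hQ h.toIsFeasible) ht

/-- Adding a constant to a feasible regulator compensates a downward perturbation of the path. -/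
lemma IsFeasible.add_const (hQ : IsTransient Q) (h : IsFeasible Q S w L) {e : Fin d → ℝ}
    (he : 0 ≤ e) (hvw : ∀ t ∈ S, w t - e ≤ v t) :
    IsFeasible Q S v (fun t => L t + (reflMatrix Q)⁻¹ *ᵥ e) where
  mono s hs t ht hst := by
    have := h.mono hs ht hst
    exact add_le_add_left this _
  nonneg t ht := add_nonneg (h.nonneg t ht) (hQ.inv_mulVec_nonneg he)
  state_nonneg t ht := by
    rw [Matrix.mulVec_add, hQ.mulVec_inv_mulVec]
    intro i
    have h1 := h.state_nonneg t ht i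
    have h2 := hvw t ht i
    simp only [Pi.zero_apply, Pi.add_apply, Pi.sub_apply] at *
    linarith

end Regulator


variable {d : ℕ} {Q : Matrix (Fin d) (Fin d) ℝ}

/-! ### Paths that decrease at a bounded rate -/

/-- Measurable paths each coordinate `i` of which decreases at rate at most `b i`. -/
structure IsInputPath (b : Fin d → ℝ) (x : ℝ≥0 → Fin d → ℝ) : Prop where
  measurable : ∀ i, Measurable (fun t => x t i)
  sub_le : ∀ s t, s ≤ t → ∀ i, x s i - x t i ≤ b i * ((t : ℝ) - s)

/-- The path `y + x - x(0)` of the unreflected process. -/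
def freePath (x : ℝ≥0 → Fin d → ℝ) (y : Fin d → ℝ) (t : ℝ≥0) : Fin d → ℝ := y + (x t - x 0)

/-- The time reversal `u ↦ -x(t - u)`. -/
def revPath (x : ℝ≥0 → Fin d → ℝ) (t u : ℝ≥0) : Fin d → ℝ := -x (t - u)

variable {b y : Fin d → ℝ} {x : ℝ≥0 → Fin d → ℝ}

lemma IsInputPath.shift (hx : IsInputPath b x) (s : ℝ≥0) : IsInputPath b (fun u => x (s + u)) where
  measurable i := (hx.measurable i).comp (measurable_const_add s)
  sub_le u t hut i := by
    have := hx.sub_le (s + u) (s + t) (by gcongr) i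
    push_cast at this
    convert this using 2
    ring

lemma IsInputPath.rev (hb : 0 ≤ b) (hx : IsInputPath b x) (t : ℝ≥0) :
    IsInputPath b (revPath x t) where
  measurable i := ((hx.measurable i).comp (measurable_id.const_sub t)).neg
  sub_le u w huw i := by
    have h1 := hx.sub_le (t - w) (t - u) (tsub_le_tsub_left huw t) i
    have h2 : ((t - u : ℝ≥0) : ℝ) - (t - w : ℝ≥0) ≤ w - u := by
      have : (t - u : ℝ≥0) ≤ (t - w) + (w - u) := tsub_le_tsub_add_tsub
      have h3 : ((t - u : ℝ≥0) : ℝ) ≤ ((t - w : ℝ≥0) : ℝ) + ((w - u : ℝ≥0) : ℝ) := by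
        exact_mod_cast this
      rw [NNReal.coe_sub huw] at h3
      linarith
    have h3 := mul_le_mul_of_nonneg_left h2 (hb i)
    simp only [revPath, Pi.neg_apply]
    linarith

lemma IsInputPath.freePath_sub_le (hx : IsInputPath b x) (y : Fin d → ℝ) {s t : ℝ≥0} (hst : s ≤ t)
    (i : Fin d) : freePath x y s i - freePath x y t i ≤ b i * ((t : ℝ) - s) := by
  have := hx.sub_le s t hst i
  simp only [freePath, Pi.add_apply, Pi.sub_apply]
  linarith

lemma isFeasible_zero {α : Type*} [Preorder α] (S : Set α) :
    IsFeasible Q S (fun _ => 0) (fun _ => 0) where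
  mono _ _ _ _ _ := le_rfl
  nonneg _ _ := le_rfl
  state_nonneg _ _ := by simp

/-- Pushing `R L(t) = e + t b` compensates both the worst initial deficit `e` and a decrease at the
full rate `b`. This supplies the feasible regulator that the existence of a minimal one requires. -/
lemma IsInputPath.isFeasible_linear (hQ : IsTransient Q) (hb : 0 ≤ b) (hx : IsInputPath b x)
    {e : Fin d → ℝ} (he : 0 ≤ e) (hy : -e ≤ y) (S : Set ℝ≥0) :
    IsFeasible Q S (freePath x y) (fun t => (reflMatrix Q)⁻¹ *ᵥ (e + (t : ℝ) • b)) where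
  mono s _ t _ hst := by
    refine hQ.inv_mono (add_le_add_right ?_ e)
    exact smul_le_smul_of_nonneg_right (by exact_mod_cast hst) hb
  nonneg t _ := hQ.inv_mulVec_nonneg (add_nonneg he (smul_nonneg t.2 hb))
  state_nonneg t _ := by
    rw [hQ.mulVec_inv_mulVec]
    intro i
    have h1 := hx.freePath_sub_le y (zero_le (a := t)) i
    have h2 := hy i
    simp only [freePath, Pi.add_apply, Pi.sub_apply, Pi.neg_apply, Pi.smul_apply, smul_eq_mul,
      NNReal.coe_zero, Pi.zero_apply] at *
    linarith

lemma IsInputPath.isRegulator (hQ : IsTransient Q) (hb : 0 ≤ b) (hx : IsInputPath b x)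
    (y : Fin d → ℝ) (S : Set ℝ≥0) :
    IsRegulator Q S (freePath x y) (minReg Q S (freePath x y)) :=
  isRegulator_minReg hQ (hx.isFeasible_linear hQ hb (e := fun i => |y i|) (fun _ => abs_nonneg _)
    (fun _ => neg_abs_le _) S)

/-- The state at time `t` of the reflection of the path `x` started from `y`. -/
noncomputable def skState (Q : Matrix (Fin d) (Fin d) ℝ) (x : ℝ≥0 → Fin d → ℝ) (y : Fin d → ℝ)
    (t : ℝ≥0) : Fin d → ℝ :=
  freePath x y t + reflMatrix Q *ᵥ minReg Q (Iic t) (freePath x y) t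

/-- The regulator property refers only to the past, so regulators for different horizons agree where
both are defined. -/
lemma IsRegulator.skState_eq (hQ : IsTransient Q) {T : ℝ≥0} {L : ℝ≥0 → Fin d → ℝ}
    (h : IsRegulator Q (Iic T) (freePath x y) L) {t : ℝ≥0} (ht : t ≤ T) :
    skState Q x y t = freePath x y t + reflMatrix Q *ᵥ L t := by
  have h' : IsRegulator Q (Iic t) (freePath x y) L :=
    h.mono_set (Iic_subset_Iic.2 ht) fun u hu s _ hsu => hsu.trans hu
  rw [skState, h'.eq_minReg hQ self_mem_Iic]

lemma IsInputPath.skState_nonneg (hQ : IsTransient Q) (hb : 0 ≤ b) (hx : IsInputPath b x)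
    (y : Fin d → ℝ) (t : ℝ≥0) : 0 ≤ skState Q x y t :=
  (hx.isRegulator hQ hb y (Iic t)).state_nonneg t self_mem_Iic

/-! ### Restarting and time reversal -/

/-- Needs from before time `s` are already covered by `L s`, so only the needs after `s` constrain
the increment `L (s + u) - L s`. -/
lemma IsRegulator.restart {v L : ℝ≥0 → Fin d → ℝ} {s T : ℝ≥0}
    (h : IsRegulator Q (Iic (s + T)) v L) :
    IsRegulator Q (Iic T) (fun u => v (s + u) + reflMatrix Q *ᵥ L s) (fun u => L (s + u) - L s) := by
  have hmem : ∀ {u}, u ∈ Iic T → s + u ∈ Iic (s + T) := fun hu => add_le_add_right hu s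
  have hs : s ∈ Iic (s + T) := mem_Iic.2 le_self_add
  refine ⟨⟨fun u hu w hw huw => ?_, fun u hu => ?_, fun u hu => ?_⟩, fun u hu i m hm H => ?_⟩
  · exact sub_le_sub_right (h.mono (hmem hu) (hmem hw) (by gcongr)) _
  · exact sub_nonneg.2 (h.mono hs (hmem hu) le_self_add)
  · have := h.state_nonneg _ (hmem hu)
    rw [Matrix.mulVec_sub]
    convert this using 1
    abel
  · rw [Pi.sub_apply, sub_le_iff_le_add]
    have h0 := h.nonneg s hs i
    simp only [Pi.zero_apply] at h0
    refine h.le_of_forall _ (hmem hu) i _ (by linarith) fun w hw hwu => ?_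
    rcases le_total w s with hws | hsw
    · have h1 := h.sub_le hw i
      have h2 := h.mono hw hs hws i
      linarith
    · obtain ⟨w', rfl⟩ := exists_add_of_le hsw
      have h1 := H w' (by simpa using (le_of_add_le_add_left hw)) (le_of_add_le_add_left hwu)
      rw [Matrix.mulVec_sub] at h1
      simp only [Pi.sub_apply, Pi.add_apply, reflMatrix_mulVec] at h1
      linarith

/-- The flow property of the reflection map. -/
lemma IsInputPath.skState_add (hQ : IsTransient Q) (hb : 0 ≤ b) (hx : IsInputPath b x)
    (y : Fin d → ℝ) (s T : ℝ≥0) :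
    skState Q x y (s + T) = skState Q (fun u => x (s + u)) (skState Q x y s) T := by
  have h := hx.isRegulator hQ hb y (Iic (s + T))
  set L := minReg Q (Iic (s + T)) (freePath x y)
  have hfree : (fun u => freePath x y (s + u) + reflMatrix Q *ᵥ L s)
      = freePath (fun u => x (s + u)) (skState Q x y s) := by
    funext u
    rw [h.skState_eq hQ (le_self_add : s ≤ s + T)]
    simp only [freePath, add_zero]
    abel
  have h' := h.restart
  rw [hfree] at h'
  rw [h'.skState_eq hQ le_rfl, h.skState_eq hQ le_rfl, ← hfree, Matrix.mulVec_sub]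
  ext i
  simp only [Pi.add_apply, Pi.sub_apply]
  ring

/-- If `τ` is a common record time, seen from the future, of the coordinates of `x(u) - u z`, then
the reflection of the reversed path is empty when the reversed path passes `τ`. -/
lemma IsInputPath.skState_revPath_eq_zero (hQ : IsTransient Q) (hb : 0 ≤ b) (hx : IsInputPath b x)
    {z : Fin d → ℝ} (hz : ∀ i, ((reflMatrix Q)⁻¹ *ᵥ z) i < 0) {τ t : ℝ≥0} (hτt : τ ≤ t)
    (hτ : ∀ u, τ ≤ u → x u - (u : ℝ) • z ≤ x τ - (τ : ℝ) • z)
    (hy : y + (x t - (t : ℝ) • z) ≤ x τ - (τ : ℝ) • z) :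
    skState Q (revPath x t) y (t - τ) = 0 := by
  have hreg := (hx.rev hb t).isRegulator hQ hb y (Iic (t - τ))
  set ℓ : Fin d → ℝ := (x τ - (τ : ℝ) • z) - (y + (x t - (t : ℝ) • z))
  have hℓ : 0 ≤ ℓ := sub_nonneg.2 hy
  have hz' : 0 ≤ -((reflMatrix Q)⁻¹ *ᵥ z) := fun i => by simpa using (hz i).le
  -- With `Z(u) = x(u) - u z`, this regulator leads to the state `Z(τ) - Z(t - u)`. It is
  -- non-negative because `t - u ≥ τ` and `τ` is a record time.
  have hfeas : IsFeasible Q (Iic (t - τ)) (freePath (revPath x t) y)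
      (fun u => (u : ℝ) • -((reflMatrix Q)⁻¹ *ᵥ z) + (reflMatrix Q)⁻¹ *ᵥ ℓ) := by
    refine ⟨fun u _ w _ huw => ?_, fun u _ => ?_, fun u hu => ?_⟩
    · exact add_le_add_left (smul_le_smul_of_nonneg_right (by exact_mod_cast huw) hz') _
    · exact add_nonneg (smul_nonneg u.2 hz') (hQ.inv_mulVec_nonneg hℓ)
    · rw [Matrix.mulVec_add, Matrix.mulVec_smul, Matrix.mulVec_neg, hQ.mulVec_inv_mulVec,
        hQ.mulVec_inv_mulVec]
      have hut : u ≤ t := (mem_Iic.1 hu).trans tsub_le_self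
      have h1 := hτ (t - u) (by
        have := tsub_le_tsub_left (mem_Iic.1 hu) t
        rwa [tsub_tsub_cancel_of_le hτt] at this)
      intro i
      have h2 := h1 i
      rw [NNReal.coe_sub hut] at h2
      simp only [ℓ, freePath, revPath, Pi.add_apply, Pi.sub_apply, Pi.neg_apply, Pi.smul_apply,
        smul_eq_mul, Pi.zero_apply, tsub_zero] at h2 ⊢
      linarith
  have hle := hreg.le_of_isFeasible hQ hfeas self_mem_Iic
  have hY := (hx.rev hb t).skState_nonneg hQ hb y (t - τ)
  -- The comparison regulator yields the state `0` at `t - τ`. Since `R⁻¹ Y = R⁻¹ v + L`, minimality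
  -- of `L` gives `R⁻¹ Y ≤ 0`, while `Y ≥ 0` and `R⁻¹ ≥ 0` give the converse.
  have hKY : (reflMatrix Q)⁻¹ *ᵥ skState Q (revPath x t) y (t - τ) = 0 := by
    refine le_antisymm ?_ (hQ.inv_mulVec_nonneg hY)
    rw [skState, Matrix.mulVec_add, hQ.inv_mulVec_mulVec]
    have hv : freePath (revPath x t) y (t - τ) = ((t - τ : ℝ≥0) : ℝ) • z - ℓ := by
      rw [NNReal.coe_sub hτt]
      ext i
      simp only [ℓ, freePath, revPath, Pi.add_apply, Pi.sub_apply, Pi.neg_apply, Pi.smul_apply,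
        smul_eq_mul, tsub_zero, tsub_tsub_cancel_of_le hτt]
      ring
    rw [hv, Matrix.mulVec_sub, Matrix.mulVec_smul]
    intro i
    have := hle i
    simp only [Pi.add_apply, Pi.sub_apply, Pi.smul_apply, Pi.neg_apply, smul_eq_mul,
      Pi.zero_apply] at this ⊢
    linarith
  rw [← hQ.mulVec_inv_mulVec (skState Q (revPath x t) y (t - τ)), hKY, Matrix.mulVec_zero]

/-- Coalescence: the reflection of the reversed path started far enough in the past, from any state,
ends in the state that one obtains by starting empty at a future record time. -/
lemma IsInputPath.skState_revPath_eq (hQ : IsTransient Q) (hb : 0 ≤ b) (hx : IsInputPath b x)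
    {z : Fin d → ℝ} (hz : ∀ i, ((reflMatrix Q)⁻¹ *ᵥ z) i < 0) {τ t : ℝ≥0} (hτt : τ ≤ t)
    (hτ : ∀ u, τ ≤ u → x u - (u : ℝ) • z ≤ x τ - (τ : ℝ) • z)
    (hy : y + (x t - (t : ℝ) • z) ≤ x τ - (τ : ℝ) • z) :
    skState Q (revPath x t) y t = skState Q (revPath x τ) 0 τ := by
  have h := (hx.rev hb t).skState_add hQ hb y (t - τ) τ
  rw [tsub_add_cancel_of_le hτt, hx.skState_revPath_eq_zero hQ hb hz hτt hτ hy] at h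
  rw [h]
  congr 1
  funext u
  simp only [revPath]
  rw [← tsub_tsub, tsub_tsub_cancel_of_le hτt]


variable {d : ℕ} {Q : Matrix (Fin d) (Fin d) ℝ} {b y : Fin d → ℝ} {x : ℝ≥0 → Fin d → ℝ}

/-! ### Solutions of the Skorokhod problem -/

lemma measurable_skorokhod_state (hx : IsInputPath b x) (y : Fin d → ℝ)
    (L : Fin d → StieltjesFunction ℝ≥0) (i : Fin d) :
    Measurable (fun s => (freePath x y s + reflMatrix Q *ᵥ (fun j => L j s)) i) := by
  simp only [freePath, Pi.add_apply, Pi.sub_apply, Matrix.mulVec, dotProduct]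
  refine (((hx.measurable i).sub_const _).const_add _).add ?_
  exact Finset.measurable_sum _ fun j _ => (L j).mono.measurable.const_mul _

/-- The regulator of a solution of the Skorokhod problem is the minimal one. -/
lemma isRegulator_of_isSkorokhodSolution (hx : IsInputPath b x) {T : ℝ≥0}
    {Y : ℝ≥0 → Fin d → ℝ} {L : Fin d → StieltjesFunction ℝ≥0}
    (h : IsSkorokhodSolution (reflMatrix Q) x y T Y L) :
    IsRegulator Q (Iic T) (freePath x y) (fun t i => L i t) := by
  have hF : IsFeasible Q (Iic T) (freePath x y) (fun t i => L i t) := by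
    refine ⟨fun s _ t _ hst i => (L i).mono hst, fun t _ i => ?_, fun t ht => ?_⟩
    · have := (L i).mono (zero_le (a := t))
      simpa [h.reg_zero i] using this
    · have := h.nonneg t ht
      rwa [h.eqn t ht] at this
  refine ⟨hF, fun t ht i m hm H => ?_⟩
  by_contra! hlt
  set g : ℝ≥0 → ℝ := fun s => (freePath x y s + reflMatrix Q *ᵥ (fun j => L j s)) i
  -- Where `L i` exceeds `m`, the state satisfies `Y i ≥ L i - m > 0`, so by complementarity `L i`
  -- cannot grow there.
  have hnull : ∀ A : Set ℝ≥0, A ⊆ Iic t → (∀ s ∈ A, m < L i s) → (L i).measure A = 0 := by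
    intro A hA hAm
    have h0 : ∫⁻ s in Iic T, ENNReal.ofReal (g s) ∂(L i).measure = 0 := by
      rw [← h.compl i]
      refine setLIntegral_congr_fun measurableSet_Iic fun s hs => ?_
      simp only [g]
      rw [h.eqn s hs]
      rfl
    rw [lintegral_eq_zero_iff (measurable_skorokhod_state hx y L i).ennreal_ofReal] at h0
    have h1 := (ae_restrict_iff' measurableSet_Iic).1 h0
    rw [ae_iff] at h1
    refine measure_mono_null (fun s hs => ?_) h1
    have hsT : s ∈ Iic T := mem_Iic.2 ((mem_Iic.1 (hA hs)).trans ht)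
    have h2 := H s hsT (hA hs)
    have h3 := hAm s hs
    simp only [mem_ofPred_eq, Classical.not_imp, Pi.zero_apply, ENNReal.ofReal_eq_zero, not_le]
    refine ⟨hsT, ?_⟩
    simp only [Pi.add_apply, reflMatrix_mulVec]
    linarith
  set A : Set ℝ≥0 := {s | m < L i s}
  have htA : t ∈ A := hlt
  -- At the first passage `s₀` above `m`: no mass on `(s₀, t]` puts `L i s₀` above `m` already, and
  -- no mass on `[s₀, t]` excludes a jump at `s₀`, although the left limit there is at most `m`. The
  -- start is harmless since `L i 0 = 0 ≤ m` makes `s₀ ≠ 0`.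
  set s₀ := sInf A
  have hs₀t : s₀ ≤ t := csInf_le (OrderBot.bddBelow A) htA
  have hgt : ∀ s, s₀ < s → m < L i s := fun s hs => by
    obtain ⟨a, ha, has⟩ := exists_lt_of_csInf_lt ⟨t, htA⟩ hs
    exact lt_of_lt_of_le ha ((L i).mono has.le)
  have h1 := hnull (Ioc s₀ t) (fun s hs => hs.2) (fun s hs => hgt s hs.1)
  rw [StieltjesFunction.measure_Ioc, ENNReal.ofReal_eq_zero] at h1
  have hs₀ : m < L i s₀ := by linarith
  have h2 := hnull (Icc s₀ t) (fun s hs => hs.2) fun s hs => hs₀.trans_le ((L i).mono hs.1)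
  rw [StieltjesFunction.measure_Icc, ENNReal.ofReal_eq_zero] at h2
  have hpos : s₀ ≠ 0 := by
    intro h0
    rw [h0, h.reg_zero i] at hs₀
    linarith
  have hne : (nhdsWithin s₀ (Iio s₀)).NeBot := by
    rw [← mem_closure_iff_nhdsWithin_neBot, closure_Iio' ⟨0, pos_iff_ne_zero.2 hpos⟩]
    exact self_mem_Iic
  have h3 : Function.leftLim (L i) s₀ ≤ m := by
    refine le_of_tendsto ((L i).mono.tendsto_leftLim s₀) ?_
    filter_upwards [self_mem_nhdsWithin] with s hs
    by_contra! hsm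
    exact absurd (csInf_le (OrderBot.bddBelow A) hsm) (not_le.2 hs)
  linarith

/-- Uniqueness for the Skorokhod problem, and the identification of every solution with the
reflection built from the minimal regulator. -/
lemma IsSkorokhodSolution.eq_skState (hQ : IsTransient Q) (hx : IsInputPath b x) {T : ℝ≥0}
    {Y : ℝ≥0 → Fin d → ℝ} {L : Fin d → StieltjesFunction ℝ≥0}
    (h : IsSkorokhodSolution (reflMatrix Q) x y T Y L) {t : ℝ≥0} (ht : t ≤ T) :
    Y t = skState Q x y t := by
  rw [(isRegulator_of_isSkorokhodSolution hx h).skState_eq hQ ht, h.eqn t ht]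
  rfl

/-- Freezing the minimal regulator at time `s` and from then on pushing at the constant rate `R⁻¹ b`
is feasible. The minimal regulator is therefore Lipschitz in time, although the path may jump
upwards. -/
lemma IsInputPath.minReg_le_add (hQ : IsTransient Q) (hb : 0 ≤ b) (hx : IsInputPath b x)
    (y : Fin d → ℝ) {s t : ℝ≥0} (hst : s ≤ t) :
    minReg Q univ (freePath x y) t
      ≤ minReg Q univ (freePath x y) s + ((t : ℝ) - s) • ((reflMatrix Q)⁻¹ *ᵥ b) := by
  have h := hx.isRegulator hQ hb y univ
  set M := minReg Q univ (freePath x y)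
  have hF : IsFeasible Q univ (freePath x y)
      (fun u => M (min u s) + ((u - s : ℝ≥0) : ℝ) • ((reflMatrix Q)⁻¹ *ᵥ b)) := by
    have hKb := hQ.inv_mulVec_nonneg hb
    refine ⟨fun u _ w _ huw => ?_, fun u _ => ?_, fun u _ => ?_⟩
    · refine add_le_add (h.mono (mem_univ _) (mem_univ _) (min_le_min_right _ huw)) ?_
      refine smul_le_smul_of_nonneg_right ?_ hKb
      exact_mod_cast tsub_le_tsub_right huw s
    · exact add_nonneg (h.nonneg _ (mem_univ _)) (smul_nonneg (NNReal.coe_nonneg _) hKb)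
    · intro i
      have h1 := h.state_nonneg (min u s) (mem_univ _) i
      have h2 := hx.freePath_sub_le y (min_le_left u s) i
      have h3 : (u : ℝ) - (min u s : ℝ≥0) = ((u - s : ℝ≥0) : ℝ) := by
        rcases le_total u s with hus | hus
        · simp [hus, tsub_eq_zero_of_le hus]
        · simp [hus, NNReal.coe_sub hus]
      rw [h3] at h2
      rw [Matrix.mulVec_add, Matrix.mulVec_smul, hQ.mulVec_inv_mulVec]
      simp only [Pi.zero_apply, Pi.add_apply, Pi.smul_apply, smul_eq_mul] at *
      linarith
  have := minReg_le hF (mem_univ t)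
  rwa [min_eq_right hst, NNReal.coe_sub hst] at this

lemma IsInputPath.continuous_minReg (hQ : IsTransient Q) (hb : 0 ≤ b) (hx : IsInputPath b x)
    (y : Fin d → ℝ) (i : Fin d) : Continuous fun t => minReg Q univ (freePath x y) t i := by
  set M := minReg Q univ (freePath x y)
  have hC : 0 ≤ ((reflMatrix Q)⁻¹ *ᵥ b) i := hQ.inv_mulVec_nonneg hb i
  have key : ∀ s t : ℝ≥0, s ≤ t → dist (M s i) (M t i) ≤ ((reflMatrix Q)⁻¹ *ᵥ b) i * dist s t := by
    intro s t hst
    have h1 := hx.minReg_le_add hQ hb y hst i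
    have h2 := (hx.isRegulator hQ hb y univ).mono (mem_univ s) (mem_univ t) hst i
    have hst' : (s : ℝ) ≤ t := by exact_mod_cast hst
    simp only [Pi.add_apply, Pi.smul_apply, smul_eq_mul] at h1
    rw [NNReal.dist_eq, Real.dist_eq, abs_of_nonpos (by linarith), abs_of_nonpos (by linarith)]
    linarith
  refine (LipschitzWith.of_dist_le_mul (K := ⟨_, hC⟩) fun s t => ?_).continuous
  rcases le_total s t with h | h
  · exact key s t h
  · rw [dist_comm, dist_comm s t]
    exact key t s h

/-- The regulator does not increase immediately after a time at which the state is positive. -/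
lemma IsInputPath.exists_gt_minReg_eq (hQ : IsTransient Q) (hb : 0 ≤ b) (hx : IsInputPath b x)
    (y : Fin d → ℝ) (i : Fin d) {s : ℝ≥0}
    (hs : 0 < (freePath x y s + reflMatrix Q *ᵥ minReg Q univ (freePath x y) s) i) :
    ∃ t, s < t ∧ minReg Q univ (freePath x y) t i = minReg Q univ (freePath x y) s i := by
  have h := hx.isRegulator hQ hb y univ
  have hlip : ∀ s t, s ≤ t → _ := fun s t hst => hx.minReg_le_add hQ hb y (s := s) (t := t) hst
  set M := minReg Q univ (freePath x y)
  set ε := (freePath x y s + reflMatrix Q *ᵥ M s) i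
  have hC : 0 ≤ ((reflMatrix Q)⁻¹ *ᵥ b) i := hQ.inv_mulVec_nonneg hb i
  set C := ((reflMatrix Q)⁻¹ *ᵥ b) i
  have hCb : C = (Qᵀ *ᵥ ((reflMatrix Q)⁻¹ *ᵥ b)) i + b i := by
    have := reflMatrix_mulVec Q ((reflMatrix Q)⁻¹ *ᵥ b) i
    rw [hQ.mulVec_inv_mulVec] at this
    linarith
  have hη : 0 < ε / (C + 1) := by positivity
  -- In a time `u - s` the need of coordinate `i` rises by at most `(u - s) C`, by `C = (Qᵀ R⁻¹ b +
  -- b) i`, and at `s` it lies `ε` below `M s i`. The `+ 1` only keeps the denominator positive.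
  refine ⟨s + ⟨ε / (C + 1), hη.le⟩, lt_add_of_pos_right s hη, le_antisymm ?_
    (h.mono (mem_univ _) (mem_univ _) le_self_add i)⟩
  have hMs := h.nonneg s (mem_univ _) i
  refine h.le_of_forall _ (mem_univ _) i _ hMs fun u _ hu => ?_
  rcases le_total u s with hus | hsu
  · exact (h.sub_le (mem_univ u) i).trans (h.mono (mem_univ _) (mem_univ _) hus i)
  · have h1 := hQ.transpose_mono (hlip s u hsu) i
    have h2 := hx.freePath_sub_le y hsu i
    rw [Matrix.mulVec_add, Matrix.mulVec_smul] at h1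
    have h3 : (u : ℝ) - s ≤ ε / (C + 1) := by
      have : (u : ℝ) ≤ s + ε / (C + 1) := by exact_mod_cast hu
      linarith
    have h4 : ((u : ℝ) - s) * C ≤ ε := by
      have hsu' : (0 : ℝ) ≤ u - s := sub_nonneg.2 (by exact_mod_cast hsu)
      calc ((u : ℝ) - s) * C ≤ ε / (C + 1) * (C + 1) := by gcongr; linarith
        _ = ε := by field_simp
    have h5 : ε = freePath x y s i + (M s i - (Qᵀ *ᵥ M s) i) := by
      simp only [ε, Pi.add_apply, reflMatrix_mulVec]
    simp only [Pi.add_apply, Pi.smul_apply, smul_eq_mul] at h1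
    rw [hCb] at h4
    linarith

/-- Paths that decrease at a bounded rate can be reflected, on all of `[0, ∞)`. -/
lemma IsInputPath.exists_isSkorokhodSolution (hQ : IsTransient Q) (hb : 0 ≤ b)
    (hx : IsInputPath b x) (hy : 0 ≤ y) :
    ∃ L : Fin d → StieltjesFunction ℝ≥0, ∀ T,
      IsSkorokhodSolution (reflMatrix Q) x y T (skState Q x y) L := by
  have h := hx.isRegulator hQ hb y univ
  set M := minReg Q univ (freePath x y) with hM
  have hcont := hx.continuous_minReg hQ hb y
  let L : Fin d → StieltjesFunction ℝ≥0 := fun i =>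
    ⟨fun t => M t i, fun s t hst => h.mono (mem_univ _) (mem_univ _) hst i,
      fun t => (hcont i).continuousWithinAt⟩
  have hL : ∀ i t, L i t = M t i := fun _ _ => rfl
  have hst : ∀ t, skState Q x y t = freePath x y t + reflMatrix Q *ᵥ M t := fun t =>
    (h.mono_set (subset_univ (Iic t)) fun u hu s _ hsu => hsu.trans hu).skState_eq hQ le_rfl
  refine ⟨L, fun T => ⟨fun t _ => hst t, fun t _ => hx.skState_nonneg hQ hb y t, fun i => ?_,
    fun i => ?_⟩⟩
  · have h1 := minReg_le (hx.isFeasible_linear hQ hb (e := 0) le_rfl (by simpa using hy) univ)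
      (mem_univ 0) i
    have h2 := h.nonneg 0 (mem_univ _) i
    simp only [NNReal.coe_zero, zero_smul, add_zero, Matrix.mulVec_zero, Pi.zero_apply] at h1 h2
    exact le_antisymm h1 h2
  -- The set on which the continuous monotone `M i` has its value at `q` has a first point, and the
  -- measure of the closed interval from there to `q` is the zero increment of `M i`.
  · have hq : ∀ q : ℝ≥0, (L i).measure {s | s < q ∧ M s i = M q i} = 0 := by
      intro q
      set A : Set ℝ≥0 := {s | M s i = M q i}
      have hA : IsClosed A := isClosed_eq (hcont i) continuous_const
      have hqA : q ∈ A := rfl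
      have haA : sInf A ∈ A := hA.csInf_mem ⟨q, hqA⟩ (OrderBot.bddBelow A)
      refine measure_mono_null (t := Icc (sInf A) q)
        (fun s hs => ⟨csInf_le (OrderBot.bddBelow A) hs.2, hs.1.le⟩) ?_
      rw [StieltjesFunction.measure_Icc, ENNReal.ofReal_eq_zero]
      have hleft : Function.leftLim (L i) (sInf A) = L i (sInf A) :=
        (hcont i).continuousAt.continuousWithinAt.leftLim_eq
      rw [hleft, hL, hL]
      exact (sub_eq_zero.2 haA.symm).le
    obtain ⟨D, hDc, hDd⟩ := TopologicalSpace.exists_countable_dense ℝ≥0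
    have hae : ∀ᵐ s ∂(L i).measure, ENNReal.ofReal (skState Q x y s i) = 0 := by
      rw [ae_iff]
      -- A time with positive state is followed by a stretch on which `M i` is constant, and this
      -- stretch contains a point of the countable dense set `D`. Countably many null sets thus
      -- cover the times with positive state.
      refine measure_mono_null (t := ⋃ q ∈ D, {s | s < q ∧ M s i = M q i}) (fun s hs => ?_)
        ((measure_biUnion_null_iff hDc).2 fun q _ => hq q)
      simp only [mem_ofPred_eq, ENNReal.ofReal_eq_zero, not_le, hst] at hs
      obtain ⟨t, hst', ht⟩ := hx.exists_gt_minReg_eq hQ hb y i hs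
      obtain ⟨q, hqD, hsq, hqt⟩ := hDd.exists_between hst'
      refine mem_biUnion hqD ⟨hsq, le_antisymm ?_ ?_⟩
      · exact h.mono (mem_univ _) (mem_univ _) hsq.le i
      · exact (h.mono (mem_univ _) (mem_univ _) hqt.le i).trans ht.le
    rw [lintegral_congr_ae (ae_restrict_of_ae hae), lintegral_zero]

/-! ### Reflection of discrete paths -/

/-- The final state of the reflection of a discrete path. -/
noncomputable def gridState (Q : Matrix (Fin d) (Fin d) ℝ) {n : ℕ} (w : Fin (n + 1) → Fin d → ℝ) :
    Fin d → ℝ :=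
  w (Fin.last n) + reflMatrix Q *ᵥ minReg Q univ w (Fin.last n)

lemma IsTransient.isRegulator_fin (hQ : IsTransient Q) {n : ℕ} (w : Fin (n + 1) → Fin d → ℝ) :
    IsRegulator Q univ w (minReg Q univ w) := by
  refine isRegulator_minReg hQ ((isFeasible_zero univ).add_const hQ (e := fun _ => ‖w‖)
    (fun _ => norm_nonneg _) fun k _ i => ?_)
  have h1 := (norm_le_pi_norm (w k) i).trans (norm_le_pi_norm w k)
  have h2 := neg_le_of_abs_le h1
  simpa using h2

/-- Changing a path by at most `e` in every coordinate is repaired by the extra constant push `R⁻¹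
e`, so the minimal regulator is Lipschitz in the path. -/
lemma IsTransient.continuous_gridState (hQ : IsTransient Q) (n : ℕ) :
    Continuous (gridState Q : (Fin (n + 1) → Fin d → ℝ) → Fin d → ℝ) := by
  have hreg : Continuous fun w : Fin (n + 1) → Fin d → ℝ => minReg Q univ w (Fin.last n) := by
    refine continuous_pi fun i => ?_
    have hC : 0 ≤ ((reflMatrix Q)⁻¹ *ᵥ fun _ => (1 : ℝ)) i :=
      hQ.inv_mulVec_nonneg (fun _ => zero_le_one) i
    have key : ∀ w w' : Fin (n + 1) → Fin d → ℝ,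
        minReg Q univ w (Fin.last n) i
          ≤ minReg Q univ w' (Fin.last n) i
            + ((reflMatrix Q)⁻¹ *ᵥ fun _ => (1 : ℝ)) i * dist w w' := by
      intro w w'
      have h1 := ((hQ.isRegulator_fin w').toIsFeasible.add_const hQ (v := w)
        (e := dist w w' • fun _ => (1 : ℝ)) (smul_nonneg dist_nonneg fun _ => zero_le_one)
        fun k _ i => ?_)
      · have h2 := minReg_le h1 (mem_univ (Fin.last n)) i
        rw [Matrix.mulVec_smul] at h2
        simp only [Pi.add_apply, Pi.smul_apply, smul_eq_mul] at h2
        linarith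
      · have h3 := (dist_le_pi_dist (w k) (w' k) i).trans (dist_le_pi_dist w w' k)
        rw [Real.dist_eq] at h3
        have h4 := neg_le_of_abs_le h3
        simp only [Pi.sub_apply, Pi.smul_apply, smul_eq_mul, mul_one]
        linarith
    refine (LipschitzWith.of_dist_le_mul (K := ⟨_, hC⟩) fun w w' => ?_).continuous
    have h1 := key w w'
    have h2 := key w' w
    rw [dist_comm w' w] at h2
    change dist _ _ ≤ ((reflMatrix Q)⁻¹ *ᵥ fun _ => (1 : ℝ)) i * dist w w'
    rw [Real.dist_eq, abs_le]
    constructor <;> linarith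
  exact (continuous_apply _).add (Continuous.matrix_mulVec continuous_const hreg)

/-- The point number `k` of the grid with `n + 1` cells of equal length on `[0, T]`. -/
noncomputable def gridPoint (T : ℝ≥0) (n k : ℕ) : ℝ≥0 := k * (T / (n + 1))

lemma gridPoint_mono (T : ℝ≥0) (n : ℕ) : Monotone (gridPoint T n) := fun k l hkl => by
  unfold gridPoint
  gcongr

@[simp] lemma gridPoint_zero (T : ℝ≥0) (n : ℕ) : gridPoint T n 0 = 0 := by simp [gridPoint]

lemma gridPoint_last (T : ℝ≥0) (n : ℕ) : gridPoint T n (n + 1) = T := by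
  have : (n : ℝ≥0) + 1 ≠ 0 := by positivity
  rw [gridPoint]
  push_cast
  field_simp

/-- Reflection along a fine grid approximates reflection in continuous time. -/
lemma IsInputPath.abs_minReg_sub_le (hQ : IsTransient Q) (hb : 0 ≤ b) (hx : IsInputPath b x)
    (y : Fin d → ℝ) (T : ℝ≥0) (n : ℕ) (i : Fin d) :
    |minReg Q univ (fun k : Fin (n + 2) => freePath x y (gridPoint T n k)) (Fin.last (n + 1)) i
      - minReg Q (Iic T) (freePath x y) T i|
      ≤ (T : ℝ) / (n + 1) * ((reflMatrix Q)⁻¹ *ᵥ b) i := by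
  have h := hx.isRegulator hQ hb y (Iic T)
  set M := minReg Q (Iic T) (freePath x y)
  set w : Fin (n + 2) → Fin d → ℝ := fun k => freePath x y (gridPoint T n k) with hw
  have hreg := hQ.isRegulator_fin w
  have hKb : 0 ≤ ((reflMatrix Q)⁻¹ *ᵥ b) i := hQ.inv_mulVec_nonneg hb i
  have hmem : ∀ k : Fin (n + 2), gridPoint T n k ∈ Iic T := fun k => by
    have := gridPoint_mono T n (Nat.le_of_lt_succ k.2)
    rwa [gridPoint_last] at this
  -- Lower comparison: the continuous-time regulator sampled on the grid is feasible for the grid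
  -- path.
  have h1 : IsFeasible Q univ w (fun k => M (gridPoint T n k)) :=
    ⟨fun k _ l _ hkl => h.mono (hmem k) (hmem l) (gridPoint_mono T n hkl),
      fun k _ => h.nonneg _ (hmem k), fun k _ => h.state_nonneg _ (hmem k)⟩
  have hlow := minReg_le h1 (mem_univ (Fin.last (n + 1))) i
  rw [Fin.val_last, gridPoint_last] at hlow
  set δ : ℝ≥0 := T / (n + 1)
  -- Index of the last grid point not after `u`, capped at the endpoint. For the upper comparison
  -- the grid regulator is extended as a step function; within a cell the path falls by at most `δ
  -- b`, which a constant push pays for.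
  let idx : ℝ≥0 → Fin (n + 2) := fun u => ⟨min ⌊u / δ⌋₊ (n + 1), by omega⟩
  have hidx : Monotone idx := fun u u' huu' => by
    refine Fin.mk_le_mk.2 (min_le_min_right _ (Nat.floor_mono ?_))
    gcongr
  have hTδ : T = (n + 1) * δ := by
    have := gridPoint_last T n
    rw [gridPoint] at this
    push_cast at this
    exact this.symm
  have hidx_le : ∀ u, gridPoint T n (idx u) ≤ u := fun u => by
    have h2 : ((idx u : ℕ) : ℝ≥0) ≤ u / δ :=
      (Nat.cast_le.2 (min_le_left _ _)).trans (Nat.floor_le (zero_le (a := u / δ)))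
    calc gridPoint T n (idx u) ≤ u / δ * δ := mul_le_mul_left h2 δ
      _ ≤ u := by
        rcases eq_or_ne δ 0 with h0 | h0
        · simp [h0]
        · exact (div_mul_cancel₀ u h0).le
  have hidx_ge : ∀ u ≤ T, u ≤ gridPoint T n (idx u) + δ := fun u hu => by
    rcases eq_or_ne δ 0 with h0 | h0
    · rw [hTδ, h0, mul_zero] at hu
      exact hu.trans (zero_le (a := _))
    rcases le_total ⌊u / δ⌋₊ (n + 1) with hle | hle
    · have h2 : ((idx u : ℕ) : ℝ≥0) + 1 = ⌊u / δ⌋₊ + 1 := by simp [idx, hle]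
      have h3 := (Nat.lt_floor_add_one (u / δ)).le
      calc u = u / δ * δ := (div_mul_cancel₀ u h0).symm
        _ ≤ (⌊u / δ⌋₊ + 1) * δ := by gcongr
        _ = gridPoint T n (idx u) + δ := by rw [← h2, add_mul, one_mul]; rfl
    · have h2 : (idx u : ℕ) = n + 1 := by simp [idx, hle]
      rw [h2, gridPoint_last]
      exact hu.trans le_self_add
  have h2 : IsFeasible Q (Iic T) (fun u => w (idx u)) (fun u => minReg Q univ w (idx u)) :=
    ⟨fun u _ u' _ huu' => hreg.mono (mem_univ _) (mem_univ _) (hidx huu'),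
      fun u _ => hreg.nonneg _ (mem_univ _), fun u _ => hreg.state_nonneg _ (mem_univ _)⟩
  have h3 := h2.add_const hQ (v := freePath x y) (e := (δ : ℝ) • b) (smul_nonneg δ.2 hb) (by
    intro u hu i
    have h4 := hx.freePath_sub_le y (hidx_le u) i
    have h5 : (u : ℝ) ≤ gridPoint T n (idx u) + δ := by exact_mod_cast hidx_ge u hu
    have h6 : b i * ((u : ℝ) - gridPoint T n (idx u)) ≤ b i * δ :=
      mul_le_mul_of_nonneg_left (by linarith) (hb i)
    simp only [hw, Pi.sub_apply, Pi.smul_apply, smul_eq_mul]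
    linarith)
  have hup := minReg_le h3 self_mem_Iic i
  rw [Matrix.mulVec_smul] at hup
  have hup' := hreg.mono (mem_univ (idx T)) (mem_univ (Fin.last (n + 1))) (Fin.le_last _) i
  simp only [Pi.add_apply, Pi.smul_apply, smul_eq_mul, δ, NNReal.coe_div, NNReal.coe_add,
    NNReal.coe_natCast, NNReal.coe_one] at hup
  have hpos : 0 ≤ (T : ℝ) / (n + 1) * ((reflMatrix Q)⁻¹ *ᵥ b) i := by positivity
  rw [abs_le]
  constructor <;> linarith

lemma IsInputPath.tendsto_gridState (hQ : IsTransient Q) (hb : 0 ≤ b) (hx : IsInputPath b x)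
    (y : Fin d → ℝ) (T : ℝ≥0) :
    Tendsto (fun n : ℕ => gridState Q fun k : Fin (n + 2) => freePath x y (gridPoint T n k)) atTop
      (nhds (skState Q x y T)) := by
  simp only [gridState, Fin.val_last, gridPoint_last, skState]
  refine Tendsto.const_add _ ?_
  refine ((Continuous.matrix_mulVec continuous_const continuous_id).tendsto
    (minReg Q (Iic T) (freePath x y) T)).comp ?_
  rw [tendsto_pi_nhds]
  intro i
  rw [tendsto_iff_dist_tendsto_zero]
  refine squeeze_zero (fun _ => dist_nonneg)
    (fun n => (Real.dist_eq _ _).le.trans (hx.abs_minReg_sub_le hQ hb y T n i)) ?_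
  have := (tendsto_const_div_atTop_nhds_zero_nat (T : ℝ)).comp (tendsto_add_atTop_nat 1)
  simpa using this.mul_const (((reflMatrix Q)⁻¹ *ᵥ b) i)


/-! ### Independence of groups of independent variables -/

section Independence

variable {Ω E : Type*} [MeasurableSpace Ω] [MeasurableSpace E] {P : Measure Ω}

/-- If the variables indexed by the pairs `(i, j)` are independent, so are the rows. -/
lemma iIndepFun_rows [IsProbabilityMeasure P] {ι : Type*} {κ : ι → Type*}
    {X : (i : ι) → κ i → Ω → E} (mX : ∀ i j, Measurable (X i j))
    (h : iIndepFun (fun (p : (i : ι) × κ i) ω => X p.1 p.2 ω) P) :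
    iIndepFun (fun i ω => fun j => X i j ω) P := by
  have hprob : ∀ i j, IsProbabilityMeasure (P.map (X i j)) :=
    fun i j => Measure.isProbabilityMeasure_map (mX i j).aemeasurable
  rw [iIndepFun_iff_map_fun_eq_infinitePi_map (by fun_prop)]
  have hrow : ∀ i, P.map (fun ω j => X i j ω) = Measure.infinitePi fun j => P.map (X i j) :=
    fun i => (h.precomp (g := fun j : κ i => (⟨i, j⟩ : (i : ι) × κ i))
      sigma_mk_injective).map_fun_eq_infinitePi_map (mX i)
  simp_rw [hrow]
  have h1 := h.map_fun_eq_infinitePi_map (fun p : (i : ι) × κ i => mX p.1 p.2)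
  rw [← Measure.infinitePi_map_piCurry (fun i j => P.map (X i j)), ← h1,
    Measure.map_map (by fun_prop) (by fun_prop)]
  rfl

/-- Disjoint groups of independent variables are independent. -/
lemma iIndepFun.indepFun_restrict {ι : Type*} {f : ι → Ω → E} (mf : ∀ i, Measurable (f i))
    (h : iIndepFun f P) {S T : Set ι} (hST : Disjoint S T) :
    IndepFun (fun ω (i : S) => f i ω) (fun ω (i : T) => f i ω) P := by
  have := indep_iSup_of_disjoint (fun i => (mf i).comap_le) h.iIndep hST
  rw [IndepFun_iff_Indep]
  have hcomap : ∀ U : Set ι, MeasurableSpace.comap (fun ω (i : U) => f i ω) MeasurableSpace.pi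
      ≤ ⨆ i ∈ U, MeasurableSpace.comap (f i) inferInstance := fun U => by
    rw [MeasurableSpace.pi, MeasurableSpace.comap_iSup]
    refine iSup_le fun i => ?_
    rw [MeasurableSpace.comap_comp]
    exact le_iSup₂_of_le (i : ι) i.2 le_rfl
  exact indep_of_indep_of_le_left (indep_of_indep_of_le_right this (hcomap T)) (hcomap S)

/-- The increments of the partial sums of an independent sequence are independent. -/
lemma iIndepFun.sum_Ico [IsProbabilityMeasure P] [AddCommMonoid E] [MeasurableAdd₂ E]
    {W : ℕ → Ω → E} (mW : ∀ k, Measurable (W k)) (h : iIndepFun W P) {n : ℕ}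
    {a : Fin (n + 1) → ℕ} (ha : Monotone a) :
    iIndepFun (fun (k : Fin n) ω => ∑ j ∈ Finset.Ico (a k.castSucc) (a k.succ), W j ω) P := by
  let κ : Fin n → Type := fun k => {j // j ∈ Finset.Ico (a k.castSucc) (a k.succ)}
  have hinj : Function.Injective fun p : (k : Fin n) × κ k => (p.2 : ℕ) := by
    rintro ⟨k, j, hj⟩ ⟨k', j', hj'⟩ hjj
    dsimp only at hjj
    subst hjj
    rw [Finset.mem_Ico] at hj hj'
    rcases lt_trichotomy k k' with hlt | rfl | hlt
    · have := ha (show k.succ ≤ k'.castSucc from Fin.le_castSucc_iff.2 (by simpa using hlt))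
      omega
    · rfl
    · have := ha (show k'.succ ≤ k.castSucc from Fin.le_castSucc_iff.2 (by simpa using hlt))
      omega
  have h1 := iIndepFun_rows (X := fun (k : Fin n) (j : κ k) => W j) (fun _ _ => mW _)
    (h.precomp hinj)
  have h2 := h1.comp (fun k (w : κ k → E) => ∑ j, w j)
    (fun k => Finset.measurable_sum _ fun j _ => measurable_pi_apply j)
  refine (iIndepFun_congr fun k => ?_).1 h2
  refine Eventually.of_forall fun ω => ?_
  exact Finset.sum_coe_sort (Finset.Ico (a k.castSucc) (a k.succ)) fun j => W j ω

lemma identDistrib_sum_Ico [AddCommMonoid E] [MeasurableAdd₂ E]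
    {W : ℕ → Ω → E} (h : iIndepFun W P) (hid : ∀ k, IdentDistrib (W k) (W 0) P P) (p q : ℕ) :
    IdentDistrib (fun ω => ∑ j ∈ Finset.Ico p q, W j ω)
      (fun ω => ∑ j ∈ Finset.range (q - p), W j ω) P P := by
  have h1 : IdentDistrib (fun ω j => W (p + j) ω) (fun ω j => W j ω) P P :=
    IdentDistrib.pi (fun j => (hid (p + j)).trans (hid j).symm)
      (h.precomp (add_right_injective p)) h
  have h2 := h1.comp (u := fun w : ℕ → E => ∑ j ∈ Finset.range (q - p), w j)
    (Finset.measurable_sum _ fun j _ => measurable_pi_apply j)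
  simp only [Finset.sum_Ico_eq_sum_range]
  exact h2

end Independence

/-! ### The compound Poisson process -/

section CompoundPoisson

variable {Ω : Type*} [MeasurableSpace Ω] {P : Measure Ω} {d : ℕ}
  {lam : ℝ≥0} {N : ℝ≥0 → Ω → ℕ} {W : ℕ → Ω → (Fin d → ℝ)}

lemma measurable_arrivedWork (hN : IsPoissonProcess lam N P) (hW : IsJobSequence W P) (t : ℝ≥0) :
    Measurable (arrivedWork N W t) := by
  have h1 : Measurable fun p : ℕ × Ω => ∑ k ∈ Finset.range p.1, W k p.2 :=
    measurable_from_prod_countable_right fun n =>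
      Finset.measurable_sum (Finset.range n) fun k _ => hW.measurable k
  exact h1.comp ((hN.measurable t).prodMk measurable_id)

lemma arrivedWork_sub (hN : IsPoissonProcess lam N P) {s t : ℝ≥0} (hst : s ≤ t) (ω : Ω) :
    arrivedWork N W t ω - arrivedWork N W s ω = ∑ j ∈ Finset.Ico (N s ω) (N t ω), W j ω := by
  rw [arrivedWork, arrivedWork, Finset.sum_Ico_eq_sub _ (hN.mono ω hst)]

/-- The joint law of the increments of the compound Poisson process. -/
lemma measure_iInter_arrivedWork_sub [IsProbabilityMeasure P] (hN : IsPoissonProcess lam N P)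
    (hW : IsJobSequence W P) (hWN : IndepFun (fun ω k => W k ω) (fun ω t => N t ω) P) {n : ℕ} {t : Fin (n + 1) → ℝ≥0}
    (ht : Monotone t) {B : Fin n → Set (Fin d → ℝ)} (hB : ∀ k, MeasurableSet (B k)) :
    P (⋂ k : Fin n, (fun ω => arrivedWork N W (t k.succ) ω - arrivedWork N W (t k.castSucc) ω) ⁻¹'
        B k)
      = ∏ k : Fin n, ∫⁻ m, P {ω | ∑ j ∈ Finset.range m, W j ω ∈ B k}
          ∂(poissonMeasure (lam * (t k.succ - t k.castSucc))) := by
  let g : Fin n → ℕ → ℝ≥0∞ := fun k m => P {ω | ∑ j ∈ Finset.range m, W j ω ∈ B k}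
  let Nt : Ω → Fin (n + 1) → ℕ := fun ω k => N (t k) ω
  have mNt : Measurable Nt := measurable_pi_lambda _ fun k => hN.measurable _
  have mW : Measurable fun ω k => W k ω := measurable_pi_lambda _ hW.measurable
  -- Fubini over the arrival counts: with the counts frozen, the increments are sums over disjoint
  -- blocks of jobs, hence independent, with laws depending only on the block lengths. Independence
  -- of the Poisson increments then factors the remaining integral.
  have hind : IndepFun (fun ω k => W k ω) Nt P :=
    hWN.comp (ψ := fun a : ℝ≥0 → ℕ => fun k => a (t k)) measurable_id
      (measurable_pi_lambda _ fun k => measurable_pi_apply _)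
  let C : Set ((ℕ → Fin d → ℝ) × (Fin (n + 1) → ℕ)) :=
    {p | ∀ k : Fin n, ∑ j ∈ Finset.Ico (p.2 k.castSucc) (p.2 k.succ), p.1 j ∈ B k}
  have mC : MeasurableSet C := by
    have hC : C = ⋂ k : Fin n, (fun p : (ℕ → Fin d → ℝ) × (Fin (n + 1) → ℕ) =>
        ∑ j ∈ Finset.Ico (p.2 k.castSucc) (p.2 k.succ), p.1 j) ⁻¹' B k := by
      ext p; simp [C]
    rw [hC]
    refine MeasurableSet.iInter fun k => ?_
    refine measurableSet_preimage ?_ (hB k)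
    exact measurable_from_prod_countable_left fun a =>
      Finset.measurable_sum (Finset.Ico (a k.castSucc) (a k.succ)) fun j _ => measurable_pi_apply j
  have hev : (⋂ k : Fin n, (fun ω => arrivedWork N W (t k.succ) ω
      - arrivedWork N W (t k.castSucc) ω) ⁻¹' B k) = (fun ω => ((fun k => W k ω), Nt ω)) ⁻¹' C := by
    ext ω
    simp only [mem_iInter, mem_preimage, C, Nt, mem_ofPred_eq]
    refine forall_congr' fun k => ?_
    rw [arrivedWork_sub hN (ht k.castSucc_lt_succ.le)]
  have hslice : ∀ ω, (P.map fun ω k => W k ω) ((fun w => (w, Nt ω)) ⁻¹' C)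
      = ∏ k : Fin n, g k (N (t k.succ) ω - N (t k.castSucc) ω) := by
    intro ω
    have ha : Monotone (Nt ω) := fun k l hkl => hN.mono ω (ht hkl)
    rw [Measure.map_apply mW (measurableSet_preimage measurable_prodMk_right mC)]
    have h1 := iIndepFun.sum_Ico hW.measurable hW.indep ha
    have h2 := h1.meas_iInter (s := fun k => (fun ω' =>
      ∑ j ∈ Finset.Ico (Nt ω k.castSucc) (Nt ω k.succ), W j ω') ⁻¹' B k)
      fun k => ⟨B k, hB k, rfl⟩
    have h3 : (fun ω' k => W k ω') ⁻¹' ((fun w => (w, Nt ω)) ⁻¹' C)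
        = ⋂ k, (fun ω' => ∑ j ∈ Finset.Ico (Nt ω k.castSucc) (Nt ω k.succ), W j ω') ⁻¹' B k := by
      ext ω'; simp [C]
    rw [h3, h2]
    refine Finset.prod_congr rfl fun k _ => ?_
    exact (identDistrib_sum_Ico hW.indep hW.identDistrib _ _).measure_mem_eq (hB k)
  rw [hev, ← Measure.map_apply (mW.prodMk mNt) mC,
    (indepFun_iff_map_prod_eq_prod_map_map mW.aemeasurable mNt.aemeasurable).1 hind]
  have := Measure.isProbabilityMeasure_map (μ := P) mW.aemeasurable
  have := Measure.isProbabilityMeasure_map (μ := P) mNt.aemeasurable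
  rw [Measure.prod_apply_symm mC, lintegral_map (measurable_measure_prodMk_right mC) mNt]
  simp_rw [hslice]
  have h4 := lintegral_prod_eq_prod_lintegral_of_indepFun Finset.univ
    (fun (k : Fin n) ω => g k (N (t k.succ) ω - N (t k.castSucc) ω))
    ((hN.indepIncrements n t ht).comp g fun k => measurable_of_countable _)
    (fun k => (measurable_of_countable (g k)).comp
      ((hN.measurable _).sub (hN.measurable _)))
  rw [h4]
  refine Finset.prod_congr rfl fun k _ => ?_
  exact (hN.law_increment _ _ (ht k.castSucc_lt_succ.le)).lintegral_comp
    (measurable_of_countable (g k)).aemeasurable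

lemma measure_arrivedWork_sub [IsProbabilityMeasure P] (hN : IsPoissonProcess lam N P)
    (hW : IsJobSequence W P) (hWN : IndepFun (fun ω k => W k ω) (fun ω t => N t ω) P) {s t : ℝ≥0} (hst : s ≤ t)
    {B : Set (Fin d → ℝ)} (hB : MeasurableSet B) :
    P ((fun ω => arrivedWork N W t ω - arrivedWork N W s ω) ⁻¹' B)
      = ∫⁻ m, P {ω | ∑ j ∈ Finset.range m, W j ω ∈ B} ∂(poissonMeasure (lam * (t - s))) := by
  have hmono : Monotone ![s, t] := by
    intro i j hij
    fin_cases i <;> fin_cases j <;> simp_all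
  have h := measure_iInter_arrivedWork_sub hN hW hWN hmono (B := fun _ => B) fun _ => hB
  have hev : ⋂ k : Fin 1, (fun ω => arrivedWork N W (![s, t] k.succ) ω
      - arrivedWork N W (![s, t] k.castSucc) ω) ⁻¹' B
      = (fun ω => arrivedWork N W t ω - arrivedWork N W s ω) ⁻¹' B := by
    ext ω
    simp only [mem_iInter, Fin.forall_fin_one]
    rfl
  rw [hev, Fin.prod_univ_one] at h
  exact h

lemma arrivedWork_hasIndepIncrements [IsProbabilityMeasure P] (hN : IsPoissonProcess lam N P)
    (hW : IsJobSequence W P) (hWN : IndepFun (fun ω k => W k ω) (fun ω t => N t ω) P) :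
    HasIndepIncrements (arrivedWork N W) P := by
  intro n t ht
  have hm : ∀ k : Fin n, Measurable fun ω =>
      arrivedWork N W (t k.succ) ω - arrivedWork N W (t k.castSucc) ω := fun k =>
    (measurable_arrivedWork hN hW _).sub (measurable_arrivedWork hN hW _)
  rw [iIndepFun_iff_map_fun_eq_pi_map fun k => (hm k).aemeasurable]
  refine (Measure.pi_eq fun B hB => ?_).symm
  rw [Measure.map_apply (measurable_pi_lambda _ hm) (MeasurableSet.univ_pi hB)]
  have h := measure_iInter_arrivedWork_sub hN hW hWN ht hB
  have hev : (fun ω (k : Fin n) => arrivedWork N W (t k.succ) ω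
      - arrivedWork N W (t k.castSucc) ω) ⁻¹' univ.pi B
      = ⋂ k : Fin n, (fun ω => arrivedWork N W (t k.succ) ω
        - arrivedWork N W (t k.castSucc) ω) ⁻¹' B k := by
    ext ω; simp
  rw [hev, h]
  refine Finset.prod_congr rfl fun k _ => ?_
  rw [Measure.map_apply (hm k) (hB k),
    measure_arrivedWork_sub hN hW hWN (ht k.castSucc_lt_succ.le) (hB k)]

lemma arrivedWork_identDistrib_sub [IsProbabilityMeasure P] (hN : IsPoissonProcess lam N P)
    (hW : IsJobSequence W P) (hWN : IndepFun (fun ω k => W k ω) (fun ω t => N t ω) P) {s t s' t' : ℝ≥0} (hst : s ≤ t)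
    (hst' : s' ≤ t') (h : t - s = t' - s') :
    IdentDistrib (fun ω => arrivedWork N W t ω - arrivedWork N W s ω)
      (fun ω => arrivedWork N W t' ω - arrivedWork N W s' ω) P P := by
  have hm : ∀ s t, Measurable fun ω => arrivedWork N W t ω - arrivedWork N W s ω := fun s t =>
    (measurable_arrivedWork hN hW _).sub (measurable_arrivedWork hN hW _)
  refine ⟨(hm _ _).aemeasurable, (hm _ _).aemeasurable, ?_⟩
  ext B hB
  rw [Measure.map_apply (hm _ _) hB, Measure.map_apply (hm _ _) hB,
    measure_arrivedWork_sub hN hW hWN hst hB, measure_arrivedWork_sub hN hW hWN hst' hB, h]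

/-- Exponential moments give integrable job requirements. -/
lemma integrable_job (hW : IsJobSequence W P)
    (hA3 : ∃ θ : Fin d → ℝ, (∀ i, 0 < θ i) ∧ Integrable (fun ω => Real.exp (θ ⬝ᵥ W 0 ω)) P)
    (i : Fin d) : Integrable (fun ω => W 0 ω i) P := by
  obtain ⟨θ, hθ, hint⟩ := hA3
  refine (hint.const_mul (θ i)⁻¹).mono'
    ((measurable_pi_apply i).comp (hW.measurable 0)).aestronglyMeasurable ?_
  filter_upwards [hW.nonneg 0] with ω hω
  have h1 : θ i * W 0 ω i ≤ θ ⬝ᵥ W 0 ω :=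
    Finset.single_le_sum (f := fun i => θ i * W 0 ω i)
      (fun j _ => mul_nonneg (hθ j).le (hω j)) (Finset.mem_univ i)
  have h2 : θ i * W 0 ω i ≤ Real.exp (θ ⬝ᵥ W 0 ω) := by
    linarith [Real.add_one_le_exp (θ ⬝ᵥ W 0 ω)]
  rw [Real.norm_of_nonneg (hω i), inv_mul_eq_div, le_div_iff₀ (hθ i)]
  linarith

lemma lintegral_poissonMeasure_lt_top (r : ℝ≥0) : ∫⁻ n : ℕ, (n : ℝ≥0∞) ∂(poissonMeasure r) < ∞ := by
  have h : Integrable (fun n : ℕ => (n : ℝ)) (poissonMeasure r) := by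
    rw [integrable_poissonMeasure_iff]
    have := (Real.summable_pow_div_factorial r).mul_left (Real.exp (-r) * r)
    refine (summable_nat_add_iff 1).1 (this.congr fun n => ?_)
    rw [Nat.factorial_succ, Real.norm_of_nonneg (by positivity)]
    push_cast
    field_simp
    ring
  have h1 := h.lintegral_lt_top
  simpa using h1

/-- Wald's bound: job `k` contributes only when `k < N t`, an event independent of its size, so
summing over `k` bounds the mean by the mean number of jobs times the mean absolute job size. -/
lemma integrable_arrivedWork [IsProbabilityMeasure P] (hN : IsPoissonProcess lam N P)
    (hW : IsJobSequence W P) (hWN : IndepFun (fun ω k => W k ω) (fun ω t => N t ω) P)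
    (hA3 : ∃ θ : Fin d → ℝ, (∀ i, 0 < θ i) ∧ Integrable (fun ω => Real.exp (θ ⬝ᵥ W 0 ω)) P)
    (t : ℝ≥0) (i : Fin d) : Integrable (fun ω => arrivedWork N W t ω i) P := by
  refine ⟨((measurable_pi_apply i).comp (measurable_arrivedWork hN hW t)).aestronglyMeasurable, ?_⟩
  have hlaw : HasLaw (N t) (poissonMeasure (lam * t)) P := by
    have := hN.law_increment 0 t (zero_le (a := t))
    simpa [hN.zero] using this
  have hmW : ∀ k, Measurable fun ω => ‖W k ω i‖ₑ := fun k =>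
    ((measurable_pi_apply i).comp (hW.measurable k)).enorm
  have hmI : ∀ k, Measurable fun ω => if k < N t ω then (1 : ℝ≥0∞) else 0 := fun k =>
    (measurable_of_countable fun m : ℕ => if k < m then (1 : ℝ≥0∞) else 0).comp (hN.measurable t)
  have hterm : ∀ k, ∫⁻ ω, (if k < N t ω then (1 : ℝ≥0∞) else 0) * ‖W k ω i‖ₑ ∂P
      = (∫⁻ ω, (if k < N t ω then (1 : ℝ≥0∞) else 0) ∂P) * ∫⁻ ω, ‖W 0 ω i‖ₑ ∂P := by
    intro k
    have hind : IndepFun (fun ω => if k < N t ω then (1 : ℝ≥0∞) else 0) (fun ω => ‖W k ω i‖ₑ) P :=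
      hWN.symm.comp (φ := fun a : ℝ≥0 → ℕ => if k < a t then (1 : ℝ≥0∞) else 0)
        (ψ := fun w : ℕ → Fin d → ℝ => ‖w k i‖ₑ)
        ((measurable_of_countable fun m : ℕ => if k < m then (1 : ℝ≥0∞) else 0).comp
          (measurable_pi_apply t)) (by fun_prop)
    refine (lintegral_mul_eq_lintegral_mul_lintegral_of_indepFun (hmI k) (hmW k) hind).trans ?_
    congr 1
    exact ((hW.identDistrib k).comp (u := fun w : Fin d → ℝ => ‖w i‖ₑ) (by fun_prop)).lintegral_eq
  have hcount : ∀ m : ℕ, ∑' k, (if k < m then (1 : ℝ≥0∞) else 0) = m := fun m => by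
    rw [tsum_eq_sum (s := Finset.range m) fun k hk => by simpa using hk]
    rw [Finset.sum_congr rfl fun k hk => if_pos (Finset.mem_range.1 hk)]
    simp
  calc ∫⁻ ω, ‖arrivedWork N W t ω i‖ₑ ∂P
      ≤ ∫⁻ ω, ∑' k, (if k < N t ω then (1 : ℝ≥0∞) else 0) * ‖W k ω i‖ₑ ∂P := by
        refine lintegral_mono fun ω => ?_
        rw [arrivedWork, Finset.sum_apply]
        refine (enorm_sum_le _ _).trans ?_
        refine le_trans (Finset.sum_le_sum fun k hk => ?_) (ENNReal.sum_le_tsum (Finset.range (N t ω)))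
        rw [if_pos (Finset.mem_range.1 hk), one_mul]
    _ = (∑' k, ∫⁻ ω, (if k < N t ω then (1 : ℝ≥0∞) else 0) ∂P) * ∫⁻ ω, ‖W 0 ω i‖ₑ ∂P := by
        rw [← ENNReal.tsum_mul_right]
        exact (lintegral_tsum fun k => ((hmI k).mul (hmW k)).aemeasurable).trans (tsum_congr hterm)
    _ = (∫⁻ n : ℕ, (n : ℝ≥0∞) ∂(poissonMeasure (lam * t))) * ∫⁻ ω, ‖W 0 ω i‖ₑ ∂P := by
        rw [← lintegral_tsum fun k => (hmI k).aemeasurable]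
        simp_rw [hcount]
        rw [← hlaw.lintegral_comp (measurable_of_countable _).aemeasurable]
    _ < ∞ := ENNReal.mul_lt_top (lintegral_poissonMeasure_lt_top _) (integrable_job hW hA3 i).2

end CompoundPoisson


/-! ### Random walks with negative drift -/

section RandomWalk

variable {Ω : Type*} [MeasurableSpace Ω] {P : Measure Ω} {d : ℕ} {D : ℕ → Ω → Fin d → ℝ}
  {c : Fin d → ℝ}

lemma ae_tendsto_sum_sub_atBot (hD : iIndepFun D P) (hid : ∀ k, IdentDistrib (D k) (D 0) P P)
    (hint : ∀ i, Integrable (fun ω => D 0 ω i) P) (hc : ∀ i, ∫ ω, D 0 ω i ∂P < c i) :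
    ∀ᵐ ω ∂P, ∀ i, Tendsto (fun n : ℕ => ∑ k ∈ Finset.range n, D k ω i - c i * n) atTop atBot := by
  rw [ae_all_iff]
  intro i
  have h := strong_law_ae_real (fun k ω => D k ω i) (hint i)
    (fun k l hkl => (hD.indepFun hkl).comp (measurable_pi_apply i) (measurable_pi_apply i))
    (fun k => (hid k).comp (measurable_pi_apply i))
  filter_upwards [h] with ω hω
  have h1 : Tendsto (fun n : ℕ => (∑ k ∈ Finset.range n, D k ω i) / n - c i) atTop
      (nhds (∫ ω, D 0 ω i ∂P - c i)) := hω.sub_const _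
  have h2 := h1.neg_mul_atTop (sub_neg.2 (hc i)) (tendsto_natCast_atTop_atTop (R := ℝ))
  refine h2.congr' ?_
  filter_upwards [eventually_ne_atTop 0] with n hn
  have hn' : (n : ℝ) ≠ 0 := Nat.cast_ne_zero.2 hn
  field_simp

/-- A random walk with negative drift that may pause has a time from which on it stays below a
line, simultaneously in all coordinates. -/
lemma ae_exists_forall_sum_le [IsProbabilityMeasure P] (mD : ∀ k, Measurable (D k))
    (hD : iIndepFun D P) (hid : ∀ k, IdentDistrib (D k) (D 0) P P)
    (hint : ∀ i, Integrable (fun ω => D 0 ω i) P) (hc : ∀ i, ∫ ω, D 0 ω i ∂P < c i)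
    (hc0 : ∀ i, 0 < c i) (h0 : P {ω | D 0 ω = 0} ≠ 0) :
    ∀ᵐ ω ∂P, ∃ n : ℕ, ∀ (m : ℕ) (i : Fin d),
      ∑ k ∈ Finset.range (m + 1), D (n + k) ω i ≤ c i * m := by
  let F : ℕ → Set (ℕ → Fin d → ℝ) := fun T =>
    {δ | ∀ (m : ℕ) (i : Fin d), ∑ k ∈ Finset.range m, δ k i ≤ c i * (T + m)}
  -- The bound at `m + 1` steps uses only `m` units of drift. The spare unit covers the fractional
  -- part of a real time when the record property is carried from integer to real times.
  let A : Set (ℕ → Fin d → ℝ) :=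
    {δ | ∀ (m : ℕ) (i : Fin d), ∑ k ∈ Finset.range (m + 1), δ k i ≤ c i * m}
  have mcoord : ∀ (k : ℕ) (i : Fin d), Measurable fun δ : ℕ → Fin d → ℝ => δ k i := fun k i =>
    (measurable_pi_apply i).comp (measurable_pi_apply k)
  have mF : ∀ T, MeasurableSet (F T) := fun T => by
    simp only [F, ofPred_forall]
    exact MeasurableSet.iInter fun m => MeasurableSet.iInter fun i =>
      measurableSet_le (Finset.measurable_sum _ fun k _ => mcoord k i) measurable_const
  have mA : MeasurableSet A := by
    simp only [A, ofPred_forall]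
    exact MeasurableSet.iInter fun m => MeasurableSet.iInter fun i =>
      measurableSet_le (Finset.measurable_sum _ fun k _ => mcoord k i) measurable_const
  have hshift : ∀ n, IdentDistrib (fun ω k => D (n + k) ω) (fun ω k => D k ω) P P := fun n =>
    IdentDistrib.pi (fun k => (hid (n + k)).trans (hid k).symm)
      (hD.precomp (add_right_injective n)) hD
  have mseq : ∀ n, Measurable fun ω k => D (n + k) ω := fun n =>
    measurable_pi_lambda _ fun k => mD _
  -- the walk stays below a line with a large enough offset
  obtain ⟨T, hT⟩ : ∃ T : ℕ, P {ω | (fun k => D k ω) ∈ F T} ≠ 0 := by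
    by_contra! hall
    have h1 : ∀ᵐ ω ∂P, ∀ T : ℕ, (fun k => D k ω) ∉ F T := by
      rw [ae_all_iff]
      exact fun T => by simpa [ae_iff] using hall T
    obtain ⟨ω, hω, hω'⟩ := (h1.and (ae_tendsto_sum_sub_atBot hD hid hint hc)).exists
    have hbdd : ∀ i, ∃ T : ℕ, ∀ m : ℕ, ∑ k ∈ Finset.range m, D k ω i - c i * m ≤ c i * T := by
      intro i
      obtain ⟨C, hC⟩ := IsBoundedUnder.bddAbove_range
        ⟨0, eventually_map.2 ((hω' i).eventually_le_atBot 0)⟩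
      obtain ⟨T, hT⟩ := exists_nat_ge (C / c i)
      refine ⟨T, fun m => (hC ⟨m, rfl⟩).trans ?_⟩
      rw [div_le_iff₀ (hc0 i)] at hT
      linarith
    choose T hT using hbdd
    refine hω (∑ i, T i) fun m i => ?_
    have h2 := hT i m
    have h3 : ((T i : ℕ) : ℝ) ≤ (∑ i, T i : ℕ) := by
      exact_mod_cast Finset.single_le_sum (f := T) (fun _ _ => Nat.zero_le _) (Finset.mem_univ i)
    have h4 := mul_le_mul_of_nonneg_left h3 (hc0 i).le
    linarith
  -- with positive probability the record condition holds at time `0`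
  have hA0 : P {ω | (fun k => D k ω) ∈ A} ≠ 0 := by
    -- A pause of `T + 1` steps earns the offset `T` and the spare unit demanded by `A`; the walk
    -- after the pause is independent of it and lies in `F T` with positive probability.
    let G : Set ((Iio (T + 1) : Set ℕ) → Fin d → ℝ) := {δ | ∀ k, δ k = 0}
    let H : Set ((Ici (T + 1) : Set ℕ) → Fin d → ℝ) :=
      {δ | (fun k : ℕ => δ ⟨T + 1 + k, by simp⟩) ∈ F T}
    have mG : MeasurableSet G := by
      simp only [G, ofPred_forall]
      exact MeasurableSet.iInter fun k => measurableSet_eq_fun (measurable_pi_apply k)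
        measurable_const
    have mH : MeasurableSet H := (measurable_pi_lambda _ fun k => measurable_pi_apply _) (mF T)
    have hind := iIndepFun.indepFun_restrict mD hD
      (show Disjoint (Iio (T + 1)) (Ici (T + 1)) from
        (Iio_disjoint_Ici le_rfl))
    have hprod := hind.measure_inter_preimage_eq_mul G H mG mH
    have hG : P ((fun ω (k : (Iio (T + 1) : Set ℕ)) => D k ω) ⁻¹' G) ≠ 0 := by
      have h1 : (fun ω (k : (Iio (T + 1) : Set ℕ)) => D k ω) ⁻¹' G
          = ⋂ k ∈ Finset.range (T + 1), D k ⁻¹' {0} := by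
        ext ω; simp [G]
      rw [h1, hD.meas_biInter fun k _ => ⟨{0}, measurableSet_singleton _, rfl⟩,
        Finset.prod_ne_zero_iff]
      intro k _
      rw [(hid k).measure_mem_eq (measurableSet_singleton _)]
      exact h0
    have hH : P ((fun ω (k : (Ici (T + 1) : Set ℕ)) => D k ω) ⁻¹' H) ≠ 0 := by
      have h1 : (fun ω (k : (Ici (T + 1) : Set ℕ)) => D k ω) ⁻¹' H
          = (fun ω k => D (T + 1 + k) ω) ⁻¹' F T := rfl
      rw [h1, (hshift (T + 1)).measure_mem_eq (mF T)]
      exact hT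
    refine fun hzero => mul_ne_zero hG hH ?_
    rw [← hprod]
    refine measure_mono_null (fun ω hω => ?_) hzero
    intro m i
    have hω1 : ∀ k < T + 1, D k ω = 0 := fun k hk => hω.1 ⟨k, hk⟩
    have hω2 : ∀ (m : ℕ) (i : Fin d), ∑ k ∈ Finset.range m, D (T + 1 + k) ω i ≤ c i * (T + m) :=
      hω.2
    rcases le_total (m + 1) (T + 1) with hm | hm
    · rw [Finset.sum_eq_zero fun k hk => ?_]
      · exact mul_nonneg (hc0 i).le (Nat.cast_nonneg _)
      · change D k ω i = 0
        rw [hω1 k ((Finset.mem_range.1 hk).trans_le hm)]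
        rfl
    · obtain ⟨l, hl⟩ := exists_add_of_le hm
      rw [hl, Finset.sum_range_add, Finset.sum_eq_zero fun k hk => ?_, zero_add]
      · have hml : (m : ℝ) = T + l := by
          have : m = T + l := by omega
          exact_mod_cast this
        rw [hml]
        exact hω2 l i
      · change D k ω i = 0
        rw [hω1 k (Finset.mem_range.1 hk)]
        rfl
  -- zero-one law
  let U : ℕ → Set Ω := fun n => ⋃ m, {ω | (fun k => D (n + m + k) ω) ∈ A}
  have mU : ∀ n, MeasurableSet (U n) := fun n =>
    MeasurableSet.iUnion fun m => mseq (n + m) mA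
  have hUanti : Antitone U := antitone_nat_of_succ_le fun n ω hω => by
    obtain ⟨m, hm⟩ := mem_iUnion.1 hω
    refine mem_iUnion.2 ⟨m + 1, ?_⟩
    rwa [show n + (m + 1) = n + 1 + m by ring]
  have hUge : ∀ n, P {ω | (fun k => D k ω) ∈ A} ≤ P (U n) := fun n => by
    refine ((hshift n).measure_mem_eq mA).symm.le.trans ?_
    exact measure_mono fun ω hω => mem_iUnion.2 ⟨0, hω⟩
  have hpos : P (⋂ n, U n) ≠ 0 := by
    have h1 := tendsto_measure_iInter_atTop (μ := P) (fun n => (mU n).nullMeasurableSet) hUanti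
      ⟨0, measure_ne_top _ _⟩
    have h2 := ge_of_tendsto' h1 hUge
    exact fun h => hA0 (le_antisymm (h2.trans h.le) (zero_le (a := _)))
  -- Since `U` is antitone, dropping its first `n` terms leaves the intersection unchanged, so the
  -- event depends only on increments from `n` on, for every `n`.
  have htail : MeasurableSet[limsup (fun k => MeasurableSpace.comap (D k) inferInstance) atTop]
      (⋂ n, U n) := by
    rw [limsup_eq_iInf_iSup_of_nat, MeasurableSpace.measurableSet_iInf]
    intro n
    have h1 : ⋂ n, U n = ⋂ l, U (n + l) := by
      refine Subset.antisymm (subset_iInter fun l => iInter_subset _ _) (subset_iInter fun l => ?_)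
      exact (iInter_subset _ l).trans (hUanti (Nat.le_add_left l n))
    rw [h1]
    refine MeasurableSet.iInter fun l => MeasurableSet.iUnion fun m => ?_
    have h2 : Measurable[⨆ k ≥ n, MeasurableSpace.comap (D k) inferInstance]
        fun ω k => D (n + l + m + k) ω := by
      refine @measurable_pi_lambda _ _ _ (_) _ _ fun k => ?_
      rw [measurable_iff_comap_le]
      exact le_iSup₂_of_le (n + l + m + k) (by omega) le_rfl
    exact h2 mA
  have hone := (measure_zero_or_one_of_measurableSet_limsup_atTop
    (fun k => (mD k).comap_le) hD.iIndep htail).resolve_left hpos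
  have hae : ∀ᵐ ω ∂P, ω ∈ ⋂ n, U n := by
    rw [← prob_compl_eq_zero_iff (MeasurableSet.iInter mU)] at hone
    exact hone
  filter_upwards [hae] with ω hω
  obtain ⟨m, hm⟩ := mem_iUnion.1 (mem_iInter.1 hω 0)
  exact ⟨0 + m, hm⟩

end RandomWalk

/-! ### Long-run behaviour of the input -/

section LongRun

variable {Ω : Type*} {d : ℕ} {N : ℝ≥0 → Ω → ℕ} {W : ℕ → Ω → (Fin d → ℝ)}
  {Q : Matrix (Fin d) (Fin d) ℝ} {r z : Fin d → ℝ}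

lemma dominatingInput_apply (t : ℝ≥0) (ω : Ω) (i : Fin d) :
    dominatingInput N W Q r z t ω i
      = arrivedWork N W t ω i - (z + reflMatrix Q *ᵥ r) i * t := by
  simp only [dominatingInput, netInput, Pi.sub_apply, Pi.smul_apply, Pi.add_apply, smul_eq_mul]
  ring

/-- The increments of the arrived work over unit intervals. -/
def workIncrement (N : ℝ≥0 → Ω → ℕ) (W : ℕ → Ω → (Fin d → ℝ)) (k : ℕ) (ω : Ω) : Fin d → ℝ :=
  arrivedWork N W (k + 1 : ℕ) ω - arrivedWork N W (k : ℕ) ω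

lemma sum_workIncrement (n m : ℕ) (ω : Ω) (i : Fin d) :
    ∑ k ∈ Finset.range m, workIncrement N W (n + k) ω i
      = arrivedWork N W (n + m : ℕ) ω i - arrivedWork N W (n : ℕ) ω i := by
  have := Finset.sum_range_sub (fun k => arrivedWork N W (n + k : ℕ) ω i) m
  rw [add_zero] at this
  rw [← this]
  rfl

end LongRun

section LongRun

variable {Ω : Type*} [MeasurableSpace Ω] {P : Measure Ω} {d : ℕ}
  {lam : ℝ≥0} {N : ℝ≥0 → Ω → ℕ} {W : ℕ → Ω → (Fin d → ℝ)}
  {Q : Matrix (Fin d) (Fin d) ℝ} {r z : Fin d → ℝ}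

lemma arrivedWork_mono (hN : IsPoissonProcess lam N P) {ω : Ω} (hω : ∀ k, 0 ≤ W k ω) :
    Monotone fun t => arrivedWork N W t ω := fun s t hst => by
  rw [← sub_nonneg, arrivedWork_sub hN hst]
  exact Finset.sum_nonneg fun k _ => hω k

lemma arrivedWork_zero (hN : IsPoissonProcess lam N P) (ω : Ω) : arrivedWork N W 0 ω = 0 := by
  simp [arrivedWork, hN.zero]

/-- What the input process satisfies along almost every path. -/
structure IsGoodPath (N : ℝ≥0 → Ω → ℕ) (W : ℕ → Ω → (Fin d → ℝ)) (Q : Matrix (Fin d) (Fin d) ℝ)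
    (r z : Fin d → ℝ) (ω : Ω) : Prop where
  nonneg : ∀ k, 0 ≤ W k ω
  tendsto : ∀ i, Tendsto (fun t => dominatingInput N W Q r z t ω i) atTop atBot
  exists_record : ∃ τ, ∀ u, τ ≤ u →
    dominatingInput N W Q r z u ω ≤ dominatingInput N W Q r z τ ω

/-- The random walk results apply to the work arriving in unit intervals and the slope `c = z + R
r`, which exceeds the mean. A pause has positive probability because `N 1 = 0` has. -/
lemma ae_isGoodPath [IsProbabilityMeasure P] (hN : IsPoissonProcess lam N P)
    (hW : IsJobSequence W P) (hWN : IndepFun (fun ω k => W k ω) (fun ω t => N t ω) P)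
    (hA3 : ∃ θ : Fin d → ℝ, (∀ i, 0 < θ i) ∧ Integrable (fun ω => Real.exp (θ ⬝ᵥ W 0 ω)) P)
    (hz : ∀ i, meanInput P N W Q r i < z i) :
    ∀ᵐ ω ∂P, IsGoodPath N W Q r z ω := by
  set c := z + reflMatrix Q *ᵥ r
  have hWnn : ∀ᵐ ω ∂P, ∀ k, 0 ≤ W k ω := ae_all_iff.2 hW.nonneg
  have mD : ∀ k, Measurable (workIncrement N W k) := fun k =>
    (measurable_arrivedWork hN hW _).sub (measurable_arrivedWork hN hW _)
  have hD : iIndepFun (workIncrement N W) P :=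
    (arrivedWork_hasIndepIncrements hN hW hWN).nat (t := fun k : ℕ => (k : ℝ≥0))
      Nat.mono_cast
  have hid : ∀ k, IdentDistrib (workIncrement N W k) (workIncrement N W 0) P P := fun k =>
    arrivedWork_identDistrib_sub hN hW hWN (by simp) (by simp) (by simp)
  have hD0 : ∀ ω, workIncrement N W 0 ω = arrivedWork N W 1 ω := fun ω => by
    simp [workIncrement, arrivedWork_zero hN]
  have hint : ∀ i, Integrable (fun ω => workIncrement N W 0 ω i) P := fun i => by
    simp_rw [hD0]
    exact integrable_arrivedWork hN hW hWN hA3 1 i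
  have hc : ∀ i, ∫ ω, workIncrement N W 0 ω i ∂P < c i := fun i => by
    have h1 := hz i
    have h2 : meanInput P N W Q r i = ∫ ω, arrivedWork N W 1 ω i ∂P - (reflMatrix Q *ᵥ r) i := by
      simp only [meanInput, netInput, NNReal.coe_one, one_smul, Pi.sub_apply]
      rw [integral_sub (integrable_arrivedWork hN hW hWN hA3 1 i) (integrable_const _)]
      simp
    simp_rw [hD0]
    simp only [c, Pi.add_apply]
    linarith
  have hc0 : ∀ i, 0 < c i := fun i => by
    refine lt_of_le_of_lt (integral_nonneg_of_ae ?_) (hc i)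
    filter_upwards [hWnn] with ω hω
    rw [hD0]
    have := arrivedWork_mono hN hω (zero_le (a := 1)) i
    simpa [arrivedWork_zero hN] using this
  have h0 : P {ω | workIncrement N W 0 ω = 0} ≠ 0 := by
    have hlaw := hN.law_increment 0 1 zero_le_one
    have h1 : P {ω | N 1 ω - N 0 ω = 0} ≠ 0 := by
      have h2 := hlaw.measure_eq (p := fun n => n = 0) (measurableSet_singleton 0)
      rw [h2]
      have h3 : {n : ℕ | n = 0} = {0} := rfl
      rw [h3, poissonMeasure_singleton]
      simp [Real.exp_pos]
    refine fun h => h1 (measure_mono_null (fun ω hω => ?_) h)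
    have hω' : N 1 ω = 0 := by simpa [hN.zero] using hω
    simp only [mem_ofPred_eq, hD0, arrivedWork, hω', Finset.range_zero, Finset.sum_empty]
  filter_upwards [hWnn, ae_tendsto_sum_sub_atBot hD hid hint hc,
    ae_exists_forall_sum_le mD hD hid hint hc hc0 h0] with ω hω hlim ⟨n, hn⟩
  have hmono := arrivedWork_mono hN hω
  refine ⟨hω, fun i => ?_, n, fun u hu i => ?_⟩
  · have h1 := (hlim i).comp ((tendsto_nat_ceil_atTop (α := ℝ≥0)))
    have h2 : Tendsto (fun t : ℝ≥0 => (∑ k ∈ Finset.range ⌈t⌉₊, workIncrement N W k ω i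
        - c i * ⌈t⌉₊) + c i) atTop atBot := tendsto_atBot_add_const_right _ _ h1
    refine tendsto_atBot_mono (fun t => ?_) h2
    have h3 := sum_workIncrement (N := N) (W := W) 0 ⌈t⌉₊ ω i
    simp only [zero_add, Nat.cast_zero, arrivedWork_zero hN, Pi.zero_apply, sub_zero] at h3
    rw [h3, dominatingInput_apply]
    have h4 := hmono (Nat.le_ceil t) i
    have h5 : (⌈t⌉₊ : ℝ) ≤ t + 1 := by
      have := (Nat.ceil_lt_add_one (zero_le (a := t))).le
      exact_mod_cast this
    have h6 := mul_le_mul_of_nonneg_left h5 (hc0 i).le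
    simp only [c] at *
    linarith
  · have hnu : n ≤ ⌊u⌋₊ := Nat.le_floor hu
    obtain ⟨m, hm⟩ := exists_add_of_le hnu
    have h1 := hn m i
    rw [sum_workIncrement] at h1
    have h2 : u ≤ (n + (m + 1) : ℕ) := by
      have := (Nat.lt_floor_add_one u).le
      rw [hm] at this
      refine this.trans (le_of_eq ?_)
      push_cast
      ring
    have h3 := hmono h2 i
    have h4 : (n : ℝ) + m ≤ u := by
      have := Nat.floor_le (zero_le (a := u))
      rw [hm] at this
      exact_mod_cast this
    have h5 := mul_le_mul_of_nonneg_left h4 (hc0 i).le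
    rw [dominatingInput_apply, dominatingInput_apply]
    simp only [c, NNReal.coe_natCast] at *
    linarith

/-- The future maxima of the dominating input are attained. -/
lemma IsGoodPath.exists_isGreatest {ω : Ω} (h : IsGoodPath N W Q r z ω)
    (hN : IsPoissonProcess lam N P) (t : ℝ≥0) (i : Fin d) :
    ∃ u, t ≤ u ∧ ∀ s, t ≤ s →
      dominatingInput N W Q r z s ω i ≤ dominatingInput N W Q r z u ω i := by
  -- The arrived work is non-decreasing, which controls it from the left, and locally constant to
  -- the right, so its jumps do not destroy maxima; the drift to `-∞` reduces the problem to a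
  -- compact interval.
  have husc : UpperSemicontinuous fun u => dominatingInput N W Q r z u ω i := by
    simp only [dominatingInput_apply, sub_eq_add_neg]
    refine UpperSemicontinuous.add (fun u y hy => ?_)
      (Continuous.upperSemicontinuous (by fun_prop))
    have hr : ∀ᶠ s in nhdsWithin u (Ici u), N s ω = N u ω :=
      (hN.rightCont ω u).eventually
        (p := fun n => n = N u ω) (by rw [nhds_discrete]; exact eventually_pure.2 rfl)
    have hl : ∀ᶠ s in nhdsWithin u (Iic u), arrivedWork N W s ω i < y := by
      filter_upwards [self_mem_nhdsWithin] with s hs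
      exact (arrivedWork_mono hN h.nonneg hs i).trans_lt hy
    rw [← nhdsLE_sup_nhdsGE, eventually_sup]
    refine ⟨hl, ?_⟩
    filter_upwards [hr] with s hs
    simpa only [arrivedWork, hs] using hy
  obtain ⟨T, hT⟩ := eventually_atTop.1
    ((h.tendsto i).eventually_le_atBot (dominatingInput N W Q r z t ω i))
  obtain ⟨u, hu, hmax⟩ := UpperSemicontinuousOn.exists_isMaxOn
    (nonempty_Icc.2 (le_max_left t T)) isCompact_Icc (husc.upperSemicontinuousOn _)
  refine ⟨u, hu.1, fun s hs => ?_⟩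
  rcases le_total s (max t T) with hsT | hsT
  · exact hmax ⟨hs, hsT⟩
  · exact (hT s ((le_max_right _ _).trans hsT)).trans (hmax ⟨le_rfl, le_max_left _ _⟩)

lemma IsGoodPath.isGreatest_futureMax {ω : Ω} (h : IsGoodPath N W Q r z ω)
    (hN : IsPoissonProcess lam N P) (t : ℝ≥0) (i : Fin d) :
    IsGreatest ((fun u => dominatingInput N W Q r z u ω i) '' Ici t)
      (futureMax (fun u => dominatingInput N W Q r z u ω) t i) := by
  obtain ⟨u, hu, hmax⟩ := h.exists_isGreatest hN t i
  have h1 : IsGreatest ((fun u => dominatingInput N W Q r z u ω i) '' Ici t)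
      (dominatingInput N W Q r z u ω i) :=
    ⟨⟨u, hu, rfl⟩, by rintro _ ⟨s, hs, rfl⟩; exact hmax s hs⟩
  rwa [futureMax, h1.csSup_eq]

lemma IsGoodPath.futureMax_eq_iff {ω : Ω} (h : IsGoodPath N W Q r z ω)
    (hN : IsPoissonProcess lam N P) (τ : ℝ≥0) :
    futureMax (fun u => dominatingInput N W Q r z u ω) τ = dominatingInput N W Q r z τ ω ↔
      ∀ u, τ ≤ u → dominatingInput N W Q r z u ω ≤ dominatingInput N W Q r z τ ω := by
  constructor
  · intro heq u hu i
    rw [← heq]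
    exact (h.isGreatest_futureMax hN τ i).2 ⟨u, hu, rfl⟩
  · intro hle
    funext i
    refine le_antisymm ?_ ((h.isGreatest_futureMax hN τ i).2 ⟨τ, self_mem_Ici, rfl⟩)
    obtain ⟨u, hu, hu'⟩ := (h.isGreatest_futureMax hN τ i).1
    rw [← hu']
    exact hle u hu i

/-- The maximal rate at which the net input decreases. -/
def drainRate (Q : Matrix (Fin d) (Fin d) ℝ) (r : Fin d → ℝ) : Fin d → ℝ :=
  fun i => max ((reflMatrix Q *ᵥ r) i) 0

lemma drainRate_nonneg (Q : Matrix (Fin d) (Fin d) ℝ) (r : Fin d → ℝ) : 0 ≤ drainRate Q r :=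
  fun _ => le_max_right _ _

lemma isInputPath_netInput (hN : IsPoissonProcess lam N P) {ω : Ω} (hω : ∀ k, 0 ≤ W k ω) :
    IsInputPath (drainRate Q r) (fun t => netInput N W Q r t ω) where
  measurable i := by
    have h1 : Monotone fun t => arrivedWork N W t ω i := fun s t hst =>
      arrivedWork_mono hN hω hst i
    simp only [netInput, Pi.sub_apply, Pi.smul_apply, smul_eq_mul]
    exact h1.measurable.sub (by fun_prop)
  sub_le s t hst i := by
    have h1 := arrivedWork_mono hN hω hst i
    have hst' : (0 : ℝ) ≤ t - s := sub_nonneg.2 (by exact_mod_cast hst)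
    have h2 := mul_le_mul_of_nonneg_right (le_max_left ((reflMatrix Q *ᵥ r) i) 0) hst'
    simp only [netInput, drainRate, Pi.sub_apply, Pi.smul_apply, smul_eq_mul] at *
    linarith

end LongRun


/-! ### Equality in law passes to almost sure limits -/

lemma tendstoInDistribution_of_map_eq {ι Ω Ω' Ξ Ξ' E : Type*} [MeasurableSpace Ω]
    [MeasurableSpace Ω'] [MeasurableSpace Ξ] [MeasurableSpace Ξ'] {μ : Measure Ω} {μ' : Measure Ω'}
    {ν : Measure Ξ} {ν' : Measure Ξ'} [IsProbabilityMeasure μ] [IsProbabilityMeasure μ']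
    [IsProbabilityMeasure ν] [IsProbabilityMeasure ν'] [TopologicalSpace E] [MeasurableSpace E]
    [OpensMeasurableSpace E] {l : Filter ι} {A : ι → Ω → E} {A' : ι → Ω' → E} {a : Ξ → E}
    {a' : Ξ' → E} (h : TendstoInDistribution A l a (fun _ => μ) ν)
    (mA' : ∀ i, AEMeasurable (A' i) μ') (ma' : AEMeasurable a' ν')
    (hA : ∀ i, μ.map (A i) = μ'.map (A' i)) (ha : ν.map a = ν'.map a') :
    TendstoInDistribution A' l a' (fun _ => μ') ν' := by
  refine ⟨mA', ma', ?_⟩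
  have h0 : ∀ i, (⟨μ.map (A i), Measure.isProbabilityMeasure_map (h.forall_aemeasurable i)⟩ :
      ProbabilityMeasure E) = ⟨μ'.map (A' i), Measure.isProbabilityMeasure_map (mA' i)⟩ :=
    fun i => Subtype.ext (hA i)
  have h1 := h.tendsto.congr h0
  have h2 : (⟨ν.map a, Measure.isProbabilityMeasure_map h.aemeasurable_limit⟩ :
      ProbabilityMeasure E) = ⟨ν'.map a', Measure.isProbabilityMeasure_map ma'⟩ := Subtype.ext ha
  rwa [h2] at h1

/-- Limits in distribution are unique. The lemma also provides the measurability of both limits. -/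
lemma identDistrib_of_tendsto {Ω Ω' E : Type*} [MeasurableSpace Ω] [MeasurableSpace Ω']
    {μ : Measure Ω} {ν : Measure Ω'} [IsProbabilityMeasure μ] [IsProbabilityMeasure ν]
    [TopologicalSpace E] [TopologicalSpace.PseudoMetrizableSpace E] [MeasurableSpace E]
    [BorelSpace E] {A : ℕ → Ω → E} {A' : ℕ → Ω' → E} {a : Ω → E} {a' : Ω' → E}
    (h : ∀ n, IdentDistrib (A n) (A' n) μ ν)
    (ha : ∀ᵐ ω ∂μ, Tendsto (fun n => A n ω) atTop (nhds (a ω)))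
    (ha' : ∀ᵐ ω ∂ν, Tendsto (fun n => A' n ω) atTop (nhds (a' ω))) : IdentDistrib a a' μ ν := by
  have mA : ∀ n, AEMeasurable (A n) μ := fun n => (h n).aemeasurable_fst
  have mA' : ∀ n, AEMeasurable (A' n) ν := fun n => (h n).aemeasurable_snd
  have ma : AEMeasurable a μ := aemeasurable_of_tendsto_metrizable_ae atTop mA ha
  have ma' : AEMeasurable a' ν := aemeasurable_of_tendsto_metrizable_ae atTop mA' ha'
  refine ⟨ma, ma', ?_⟩
  have h1 := tendstoInDistribution_of_ae_tendsto mA ma ha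
  have h2 := tendstoInDistribution_of_ae_tendsto mA' ma' ha'
  have h3 := tendstoInDistribution_of_map_eq h2 mA ma' (fun n => (h n).map_eq.symm) rfl
  exact tendstoInDistribution_unique A h1 h3

lemma identDistrib_comp_fst {Ω Ω' E : Type*} [MeasurableSpace Ω] [MeasurableSpace Ω']
    [MeasurableSpace E] {μ : Measure Ω} (ν : Measure Ω') [IsProbabilityMeasure μ]
    [IsProbabilityMeasure ν] {f : Ω → E} (hf : AEMeasurable f μ) :
    IdentDistrib (fun p : Ω × Ω' => f p.1) f (μ.prod ν) μ := by
  have h := measurePreserving_fst (μ := μ) (ν := ν)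
  refine ⟨hf.comp_quasiMeasurePreserving h.quasiMeasurePreserving, hf, ?_⟩
  have h2 : AEMeasurable f ((μ.prod ν).map Prod.fst) := by rwa [h.map_eq]
  have h3 := AEMeasurable.map_map_of_aemeasurable h2 measurable_fst.aemeasurable
  rw [h.map_eq] at h3
  exact h3.symm

lemma identDistrib_comp_snd {Ω Ω' E : Type*} [MeasurableSpace Ω] [MeasurableSpace Ω']
    [MeasurableSpace E] (μ : Measure Ω) {ν : Measure Ω'} [IsProbabilityMeasure μ]
    [IsProbabilityMeasure ν] {f : Ω' → E} (hf : AEMeasurable f ν) :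
    IdentDistrib (fun p : Ω × Ω' => f p.2) f (μ.prod ν) ν := by
  have h := measurePreserving_snd (μ := μ) (ν := ν)
  refine ⟨hf.comp_quasiMeasurePreserving h.quasiMeasurePreserving, hf, ?_⟩
  have h2 : AEMeasurable f ((μ.prod ν).map Prod.snd) := by rwa [h.map_eq]
  have h3 := AEMeasurable.map_map_of_aemeasurable h2 measurable_snd.aemeasurable
  rw [h.map_eq] at h3
  exact h3.symm

/-- Independence is an equality of the joint law with that of the pair built on the product space,
and such an equality survives almost sure limits. -/
lemma indepFun_of_tendsto {Ω E F : Type*} [MeasurableSpace Ω] {μ : Measure Ω}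
    [IsProbabilityMeasure μ] [TopologicalSpace E] [TopologicalSpace.PseudoMetrizableSpace E]
    [SecondCountableTopology E] [MeasurableSpace E] [BorelSpace E] [TopologicalSpace F]
    [TopologicalSpace.PseudoMetrizableSpace F] [SecondCountableTopology F] [MeasurableSpace F]
    [BorelSpace F] {A : ℕ → Ω → E} {a : Ω → E} {g : Ω → F} (mA : ∀ n, AEMeasurable (A n) μ)
    (mg : AEMeasurable g μ) (hA : ∀ n, IndepFun (A n) g μ)
    (ha : ∀ᵐ ω ∂μ, Tendsto (fun n => A n ω) atTop (nhds (a ω))) : IndepFun a g μ := by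
  have ma : AEMeasurable a μ := aemeasurable_of_tendsto_metrizable_ae atTop mA ha
  have h1 : ∀ᵐ p ∂μ.prod μ, Tendsto (fun n => (A n p.1, g p.2)) atTop (nhds (a p.1, g p.2)) :=
    ((measurePreserving_fst (μ := μ) (ν := μ)).quasiMeasurePreserving.ae ha).mono
      fun p hp => hp.prodMk_nhds tendsto_const_nhds
  have h2 : ∀ᵐ ω ∂μ, Tendsto (fun n => (A n ω, g ω)) atTop (nhds (a ω, g ω)) :=
    ha.mono fun ω hω => hω.prodMk_nhds tendsto_const_nhds
  exact indepFun_of_identDistrib_pair (indepFun_prod₀ ma mg) (identDistrib_of_tendsto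
    (fun n => (identDistrib_comp_fst μ (mA n)).prodMk (identDistrib_comp_snd μ mg)
      (indepFun_prod₀ (mA n) mg) (hA n)) h1 h2)

/-! ### Reflection of processes with stationary independent increments -/

section Walk

variable {Ω : Type*} {d : ℕ} {Q : Matrix (Fin d) (Fin d) ℝ} {X : ℝ≥0 → Ω → Fin d → ℝ}

/-- The increments of `X` after time `a` along the grid with `n + 1` cells of total length `T`. -/
noncomputable def gridIncrement (X : ℝ≥0 → Ω → Fin d → ℝ) (a T : ℝ≥0) (n : ℕ) (ω : Ω)
    (j : ℕ) : Fin d → ℝ :=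
  X (a + gridPoint T n (j + 1)) ω - X (a + gridPoint T n j) ω

/-- The final state of the reflection, along `n + 1` steps, of the walk with start `p.1` and
increments `p.2`. -/
noncomputable def walkState (Q : Matrix (Fin d) (Fin d) ℝ) (n : ℕ)
    (p : (Fin d → ℝ) × (ℕ → Fin d → ℝ)) : Fin d → ℝ :=
  gridState Q fun k : Fin (n + 2) => p.1 + ∑ j ∈ Finset.range k, p.2 j

lemma IsTransient.measurable_walkState (hQ : IsTransient Q) (n : ℕ) :
    Measurable (walkState Q n) := by
  refine (hQ.continuous_gridState (n + 1)).measurable.comp (measurable_pi_lambda _ fun k => ?_)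
  exact measurable_fst.add (Finset.measurable_sum _ fun j _ =>
    (measurable_pi_apply j).comp measurable_snd)

lemma walkState_congr {n : ℕ} {y : Fin d → ℝ} {ξ ξ' : ℕ → Fin d → ℝ}
    (h : ∀ j < n + 1, ξ j = ξ' j) : walkState Q n (y, ξ) = walkState Q n (y, ξ') := by
  unfold walkState
  congr 1
  funext k
  congr 1
  exact Finset.sum_congr rfl fun j hj => h j (by have := Finset.mem_range.1 hj; omega)

/-- Reversal of the first `n + 1` indices. -/
def revIndex (n j : ℕ) : ℕ := if j < n + 1 then n - j else j

lemma revIndex_injective (n : ℕ) : Function.Injective (revIndex n) := fun i j h => by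
  unfold revIndex at h
  split_ifs at h <;> omega

lemma walkState_gridIncrement (a T : ℝ≥0) (n : ℕ) (y : Fin d → ℝ) (ω : Ω) :
    walkState Q n (y, gridIncrement X a T n ω)
      = gridState Q fun k : Fin (n + 2) =>
        freePath (fun u => X (a + u) ω) y (gridPoint T n k) := by
  unfold walkState
  congr 1
  funext k
  have := Finset.sum_range_sub (fun j => X (a + gridPoint T n j) ω) k
  rw [gridPoint_zero] at this
  rw [freePath, ← this]
  rfl

/-- The grid is symmetric under `u ↦ T - u`, so reversing the path amounts to reading the same
increments backwards, with no change of sign. -/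
lemma walkState_gridIncrement_rev (T : ℝ≥0) (n : ℕ) (y : Fin d → ℝ) (ω : Ω) :
    walkState Q n (y, fun j => gridIncrement X 0 T n ω (revIndex n j))
      = gridState Q fun k : Fin (n + 2) =>
        freePath (revPath (fun u => X u ω) T) y (gridPoint T n k) := by
  unfold walkState
  congr 1
  funext k
  have hT : ∀ k ≤ n + 1, T - gridPoint T n k = gridPoint T n (n + 1 - k) := fun k hk => by
    refine tsub_eq_of_eq_add ?_
    have hnk : ((n + 1 - k : ℕ) : ℝ≥0) + k = (n + 1 : ℕ) := by
      rw [← Nat.cast_add, Nat.sub_add_cancel hk]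
    conv_lhs => rw [← gridPoint_last T n]
    rw [gridPoint, gridPoint, gridPoint, ← add_mul, hnk]
  have h := Finset.sum_range_sub (fun j => -X (gridPoint T n (n + 1 - j)) ω) k
  have hk : (k : ℕ) ≤ n + 1 := Nat.le_of_lt_succ k.2
  simp only [freePath, revPath]
  rw [hT k hk, tsub_zero]
  rw [Nat.sub_zero, gridPoint_last] at h
  rw [← h]
  congr 1
  refine Finset.sum_congr rfl fun j hj => ?_
  have hj' : j < n + 1 := (Finset.mem_range.1 hj).trans_le hk
  simp only [gridIncrement, revIndex, if_pos hj', zero_add]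
  rw [show n + 1 - (j + 1) = n - j by omega, show n + 1 - j = n - j + 1 by omega]
  abel

lemma tendsto_walkState (hQ : IsTransient Q) {b : Fin d → ℝ} (hb : 0 ≤ b) {ω : Ω}
    (hω : IsInputPath b fun t => X t ω) (a T : ℝ≥0) (y : Fin d → ℝ) :
    Tendsto (fun n => walkState Q n (y, gridIncrement X a T n ω)) atTop
      (nhds (skState Q (fun u => X (a + u) ω) y T)) := by
  simp_rw [walkState_gridIncrement]
  exact (hω.shift a).tendsto_gridState hQ hb y T

lemma tendsto_walkState_zero (hQ : IsTransient Q) {b : Fin d → ℝ} (hb : 0 ≤ b) {ω : Ω}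
    (hω : IsInputPath b fun t => X t ω) (T : ℝ≥0) (y : Fin d → ℝ) :
    Tendsto (fun n => walkState Q n (y, gridIncrement X 0 T n ω)) atTop
      (nhds (skState Q (fun u => X u ω) y T)) := by
  simpa using tendsto_walkState hQ hb hω 0 T y

lemma tendsto_walkState_rev (hQ : IsTransient Q) {b : Fin d → ℝ} (hb : 0 ≤ b) {ω : Ω}
    (hω : IsInputPath b fun t => X t ω) (T : ℝ≥0) (y : Fin d → ℝ) :
    Tendsto (fun n => walkState Q n (y, fun j => gridIncrement X 0 T n ω (revIndex n j))) atTop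
      (nhds (skState Q (revPath (fun u => X u ω) T) y T)) := by
  simp_rw [walkState_gridIncrement_rev]
  exact (hω.rev hb T).tendsto_gridState hQ hb y T

end Walk

section Levy

variable {Ω : Type*} [MeasurableSpace Ω] {P : Measure Ω} {d : ℕ} {Q : Matrix (Fin d) (Fin d) ℝ}
  {b : Fin d → ℝ} {X : ℝ≥0 → Ω → Fin d → ℝ}

/-- Processes with stationary independent increments the paths of which decrease at a bounded
rate. -/
structure IsLevyInput (b : Fin d → ℝ) (X : ℝ≥0 → Ω → Fin d → ℝ) (P : Measure Ω) : Prop where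
  measurable : ∀ t, Measurable (X t)
  indepIncrements : HasIndepIncrements X P
  identDistrib : ∀ s t s' t', s ≤ t → s' ≤ t' → t - s = t' - s' →
    IdentDistrib (fun ω => X t ω - X s ω) (fun ω => X t' ω - X s' ω) P P
  path : ∀ᵐ ω ∂P, IsInputPath b (fun t => X t ω)

namespace IsLevyInput

lemma measurable_gridIncrement (hX : IsLevyInput b X P) (a T : ℝ≥0) (n : ℕ) :
    Measurable (gridIncrement X a T n) :=
  measurable_pi_lambda _ fun _ => (hX.measurable _).sub (hX.measurable _)

lemma iIndepFun_gridIncrement (hX : IsLevyInput b X P) (a T : ℝ≥0) (n : ℕ) :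
    iIndepFun (fun j ω => gridIncrement X a T n ω j) P :=
  hX.indepIncrements.nat (t := fun j => a + gridPoint T n j)
    fun _ _ hij => add_le_add_right (gridPoint_mono T n hij) a

lemma identDistrib_gridIncrement_apply (hX : IsLevyInput b X P) (a a' T : ℝ≥0) (n j j' : ℕ) :
    IdentDistrib (fun ω => gridIncrement X a T n ω j) (fun ω => gridIncrement X a' T n ω j')
      P P := by
  have h : ∀ (a : ℝ≥0) (j : ℕ), a + gridPoint T n (j + 1) - (a + gridPoint T n j)
      = T / (n + 1) := fun a j => by
    rw [add_tsub_add_eq_tsub_left]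
    refine tsub_eq_of_eq_add ?_
    simp only [gridPoint]
    push_cast
    ring
  have hmono : ∀ (a : ℝ≥0) (j : ℕ), a + gridPoint T n j ≤ a + gridPoint T n (j + 1) := fun a j =>
    add_le_add_right (gridPoint_mono T n j.le_succ) a
  exact hX.identDistrib _ _ _ _ (hmono a j) (hmono a' j') ((h a j).trans (h a' j').symm)

lemma identDistrib_gridIncrement (hX : IsLevyInput b X P) (a a' T : ℝ≥0) (n : ℕ) :
    IdentDistrib (gridIncrement X a T n) (gridIncrement X a' T n) P P :=
  IdentDistrib.pi (fun j => hX.identDistrib_gridIncrement_apply a a' T n j j)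
    (hX.iIndepFun_gridIncrement a T n) (hX.iIndepFun_gridIncrement a' T n)

/-- The increments over equal cells are i.i.d., so permuting them preserves their joint law. -/
lemma identDistrib_gridIncrement_rev (hX : IsLevyInput b X P) (T : ℝ≥0) (n : ℕ) :
    IdentDistrib (gridIncrement X 0 T n)
      (fun ω j => gridIncrement X 0 T n ω (revIndex n j)) P P :=
  IdentDistrib.pi (fun j => hX.identDistrib_gridIncrement_apply 0 0 T n j (revIndex n j))
    (hX.iIndepFun_gridIncrement 0 T n)
    ((hX.iIndepFun_gridIncrement 0 T n).precomp (revIndex_injective n))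

variable [IsProbabilityMeasure P]

/-- Time reversal does not change the law of the reflected process at a fixed time. -/
lemma identDistrib_rev (hX : IsLevyInput b X P) (hQ : IsTransient Q) (hb : 0 ≤ b)
    (ν : Measure (Fin d → ℝ)) [IsProbabilityMeasure ν] (T : ℝ≥0) :
    IdentDistrib (fun p : Ω × (Fin d → ℝ) => skState Q (fun u => X u p.1) p.2 T)
      (fun p => skState Q (revPath (fun u => X u p.1) T) p.2 T) (P.prod ν) (P.prod ν) := by
  have hpath := (measurePreserving_fst (μ := P) (ν := ν)).quasiMeasurePreserving.ae hX.path
  refine identDistrib_of_tendsto (fun n => ?_)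
    (hpath.mono fun p hp => tendsto_walkState_zero hQ hb hp T p.2)
    (hpath.mono fun p hp => tendsto_walkState_rev hQ hb hp T p.2)
  have m1 := hX.measurable_gridIncrement 0 T n
  have m2 : Measurable fun ω j => gridIncrement X 0 T n ω (revIndex n j) :=
    measurable_pi_lambda _ fun j => (measurable_pi_apply (revIndex n j)).comp m1
  have h1 : IdentDistrib (fun p : Ω × (Fin d → ℝ) => gridIncrement X 0 T n p.1)
      (fun p => fun j => gridIncrement X 0 T n p.1 (revIndex n j)) (P.prod ν) (P.prod ν) :=
    ((identDistrib_comp_fst ν m1.aemeasurable).trans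
      (hX.identDistrib_gridIncrement_rev T n)).trans
      (identDistrib_comp_fst ν m2.aemeasurable).symm
  have h2 : IdentDistrib (fun p : Ω × (Fin d → ℝ) => p.2) (fun p => p.2) (P.prod ν) (P.prod ν) :=
    IdentDistrib.refl measurable_snd.aemeasurable
  exact (h2.prodMk h1 (indepFun_prod m1 measurable_id).symm
    (indepFun_prod m2 measurable_id).symm).comp (hQ.measurable_walkState n)

lemma identDistrib_rev_const (hX : IsLevyInput b X P) (hQ : IsTransient Q) (hb : 0 ≤ b)
    (y : Fin d → ℝ) (T : ℝ≥0) :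
    IdentDistrib (fun ω => skState Q (fun u => X u ω) y T)
      (fun ω => skState Q (revPath (fun u => X u ω) T) y T) P P := by
  refine identDistrib_of_tendsto (fun n => ?_)
    (hX.path.mono fun ω hω => tendsto_walkState_zero hQ hb hω T y)
    (hX.path.mono fun ω hω => tendsto_walkState_rev hQ hb hω T y)
  exact (hX.identDistrib_gridIncrement_rev T n).comp
    ((hQ.measurable_walkState n).comp measurable_prodMk_left)

/-- The reflected process at time `t` is independent of the later increments of the input. -/
lemma indepFun_gridIncrement (hX : IsLevyInput b X P) (hQ : IsTransient Q) (hb : 0 ≤ b)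
    (y : Fin d → ℝ) (t T : ℝ≥0) (n : ℕ) :
    IndepFun (fun ω => skState Q (fun u => X u ω) y t) (gridIncrement X t T n) P := by
  have m1 := hX.measurable_gridIncrement t T n
  have m2 : ∀ m, Measurable fun ω => walkState Q m (y, gridIncrement X 0 t m ω) := fun m =>
    (hQ.measurable_walkState m).comp
      (measurable_const.prodMk (hX.measurable_gridIncrement 0 t m))
  have hind : ∀ m, IndepFun (fun ω => walkState Q m (y, gridIncrement X 0 t m ω))
      (gridIncrement X t T n) P := by
    intro m
    -- One concatenated grid, with `m + 1` cells filling `[0, t]` and then the cells after `t`,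
    -- places past and future increments in a single independent family.
    let τ : ℕ → ℝ≥0 := fun j =>
      if j ≤ m + 1 then gridPoint t m j else t + gridPoint T n (j - (m + 1))
    have hτ1 : ∀ j ≤ m + 1, τ j = gridPoint t m j := fun j hj => if_pos hj
    have hτ2 : ∀ j, τ (m + 1 + j) = t + gridPoint T n j := fun j => by
      rcases Nat.eq_zero_or_pos j with rfl | hj
      · rw [add_zero, hτ1 _ le_rfl, gridPoint_last, gridPoint_zero, add_zero]
      · simp only [τ]
        rw [if_neg (by omega), Nat.add_sub_cancel_left]
    have hmono : Monotone τ := by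
      refine monotone_nat_of_le_succ fun j => ?_
      rcases Nat.lt_or_ge j (m + 1) with hj | hj
      · rw [hτ1 j hj.le, hτ1 (j + 1) hj]
        exact gridPoint_mono t m j.le_succ
      · obtain ⟨l, rfl⟩ := exists_add_of_le hj
        rw [hτ2, show m + 1 + l + 1 = m + 1 + (l + 1) by ring, hτ2]
        exact add_le_add_right (gridPoint_mono T n l.le_succ) t
    have h1 := hX.indepIncrements.nat hmono
    have h2 := iIndepFun.indepFun_restrict
      (fun j => (hX.measurable (τ (j + 1))).sub (hX.measurable (τ j))) h1
      (show Disjoint (Iio (m + 1)) (Ici (m + 1)) from Iio_disjoint_Ici le_rfl)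
    have h3 := h2.comp
      (φ := fun δ : (Iio (m + 1) : Set ℕ) → Fin d → ℝ =>
        walkState Q m (y, fun j => if h : j < m + 1 then δ ⟨j, h⟩ else 0))
      (ψ := fun δ : (Ici (m + 1) : Set ℕ) → Fin d → ℝ => fun j : ℕ => δ ⟨m + 1 + j, by simp⟩)
      ((hQ.measurable_walkState m).comp (measurable_const.prodMk (measurable_pi_lambda _ fun j => by
        split_ifs
        · exact measurable_pi_apply _
        · exact measurable_const)))
      (measurable_pi_lambda _ fun j => measurable_pi_apply _)
    refine h3.congr (Eventually.of_forall fun ω => ?_) (Eventually.of_forall fun ω => ?_)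
    · refine walkState_congr fun j hj => ?_
      simp only [dif_pos hj, gridIncrement, zero_add, Pi.sub_apply]
      rw [hτ1 j hj.le, hτ1 (j + 1) hj]
    · funext j
      simp only [Function.comp_apply, gridIncrement, Pi.sub_apply]
      rw [hτ2, show m + 1 + j + 1 = m + 1 + (j + 1) by ring, hτ2]
  exact indepFun_of_tendsto (fun m => (m2 m).aemeasurable) m1.aemeasurable hind
    (hX.path.mono fun ω hω => tendsto_walkState_zero hQ hb hω t y)

/-- The Markov property of the reflected process. -/
lemma identDistrib_add (hX : IsLevyInput b X P) (hQ : IsTransient Q) (hb : 0 ≤ b)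
    (y : Fin d → ℝ) (t T : ℝ≥0) :
    IdentDistrib (fun ω => skState Q (fun u => X u ω) y (t + T))
      (fun p : Ω × (Fin d → ℝ) => skState Q (fun u => X u p.1) p.2 T) P
      (P.prod (P.map fun ω => skState Q (fun u => X u ω) y t)) := by
  have hH := (hX.identDistrib_rev_const hQ hb y t).aemeasurable_fst
  have := Measure.isProbabilityMeasure_map hH
  set ν := P.map fun ω => skState Q (fun u => X u ω) y t
  have hpath := (measurePreserving_fst (μ := P) (ν := ν)).quasiMeasurePreserving.ae hX.path
  refine identDistrib_of_tendsto
    (A := fun n ω => walkState Q n (skState Q (fun u => X u ω) y t, gridIncrement X t T n ω))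
    (A' := fun n p => walkState Q n (p.2, gridIncrement X 0 T n p.1)) (fun n => ?_)
    (hX.path.mono fun ω hω => ?_)
    (hpath.mono fun p hp => tendsto_walkState_zero hQ hb hp T p.2)
  · have m1 := hX.measurable_gridIncrement 0 T n
    have h1 : IdentDistrib (gridIncrement X t T n) (fun p => gridIncrement X 0 T n p.1) P
        (P.prod ν) :=
      (hX.identDistrib_gridIncrement t 0 T n).trans (identDistrib_comp_fst ν m1.aemeasurable).symm
    have h2 : IdentDistrib (fun ω => skState Q (fun u => X u ω) y t)
        (fun p : Ω × (Fin d → ℝ) => p.2) P (P.prod ν) := by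
      refine IdentDistrib.trans ⟨hH, aemeasurable_id, ?_⟩
        (identDistrib_comp_snd P (ν := ν) (f := id) aemeasurable_id).symm
      rw [Measure.map_id]
    exact (h2.prodMk h1 (hX.indepFun_gridIncrement hQ hb y t T n)
      (indepFun_prod m1 measurable_id).symm).comp (hQ.measurable_walkState n)
  · rw [hω.skState_add hQ hb y t T]
    exact tendsto_walkState hQ hb hω t T _

/-- Randomising the initial state by an independent variable. -/
lemma identDistrib_prod_map (hX : IsLevyInput b X P) (hQ : IsTransient Q) (hb : 0 ≤ b)
    {η : Ω → Fin d → ℝ} (hη : AEMeasurable η P) (T : ℝ≥0) :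
    IdentDistrib (fun p : Ω × Ω => skState Q (fun u => X u p.1) (η p.2) T)
      (fun p : Ω × (Fin d → ℝ) => skState Q (fun u => X u p.1) p.2 T) (P.prod P)
      (P.prod (P.map η)) := by
  have := Measure.isProbabilityMeasure_map hη
  have h1 : IdentDistrib (fun p : Ω × (Fin d → ℝ) => p.1) (fun p : Ω × Ω => p.1)
      (P.prod (P.map η)) (P.prod P) :=
    (identDistrib_comp_fst (P.map η) (f := id) aemeasurable_id).trans
      (identDistrib_comp_fst P (f := id) aemeasurable_id).symm
  have h2 : IdentDistrib (fun p : Ω × (Fin d → ℝ) => p.2) (fun p : Ω × Ω => η p.2)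
      (P.prod (P.map η)) (P.prod P) := by
    refine (identDistrib_comp_snd P (f := id) aemeasurable_id).trans
      (IdentDistrib.trans ⟨aemeasurable_id, hη, ?_⟩ (identDistrib_comp_snd P hη).symm)
    rw [Measure.map_id]
  have h3 := h1.prodMk h2 (indepFun_prod measurable_id measurable_id)
    (indepFun_prod₀ (X := id) aemeasurable_id hη)
  have h4 := (hX.identDistrib_rev hQ hb (P.map η) T).aemeasurable_fst
  refine (h3.comp_of_aemeasurable
    (u := fun p : Ω × (Fin d → ℝ) => skState Q (fun u => X u p.1) p.2 T) ?_).symm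
  rwa [show (fun p : Ω × (Fin d → ℝ) => (p.1, p.2)) = id from rfl, Measure.map_id]

variable {out : Ω → Fin d → ℝ}

/-- `out` may come from a non-measurable choice of record times; it is measurable up to a null set
as the limit of the reversed states at deterministic times. -/
lemma aemeasurable_limit (hX : IsLevyInput b X P) (hQ : IsTransient Q) (hb : 0 ≤ b)
    (hout : ∀ᵐ ω ∂P, ∀ y, ∀ᶠ t in atTop,
      skState Q (revPath (fun u => X u ω) t) y t = out ω) : AEMeasurable out P := by
  refine aemeasurable_of_tendsto_metrizable_ae (atTop : Filter ℝ≥0)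
    (fun t => (hX.identDistrib_rev_const hQ hb 0 t).aemeasurable_snd) ?_
  filter_upwards [hout] with ω hω
  exact tendsto_const_nhds.congr' ((hω 0).mono fun t ht => ht.symm)

/-- Coalescence of the reversed paths gives convergence in distribution, from any initial law. -/
lemma tendstoInDistribution (hX : IsLevyInput b X P) (hQ : IsTransient Q) (hb : 0 ≤ b)
    (hout : ∀ᵐ ω ∂P, ∀ y, ∀ᶠ t in atTop,
      skState Q (revPath (fun u => X u ω) t) y t = out ω)
    (ν : Measure (Fin d → ℝ)) [IsProbabilityMeasure ν] [IsProbabilityMeasure (P.map out)] :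
    TendstoInDistribution
      (fun (t : ℝ≥0) (p : Ω × (Fin d → ℝ)) => skState Q (fun u => X u p.1) p.2 t) atTop id (fun _ => P.prod ν) (P.map out) := by
  have hm := hX.aemeasurable_limit hQ hb hout
  have hrev := fun t => hX.identDistrib_rev hQ hb ν t
  have hfst := identDistrib_comp_fst ν hm
  have h := tendstoInDistribution_of_ae_tendsto (l := (atTop : Filter ℝ≥0))
    (fun t => (hrev t).aemeasurable_snd) hfst.aemeasurable_fst (by
      filter_upwards [(measurePreserving_fst (μ := P) (ν := ν)).quasiMeasurePreserving.ae hout]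
        with p hp
      exact tendsto_const_nhds.congr' ((hp p.2).mono fun t ht => ht.symm))
  exact tendstoInDistribution_of_map_eq h (fun t => (hrev t).aemeasurable_fst) aemeasurable_id
    (fun t => (hrev t).map_eq.symm) (hfst.map_eq.trans Measure.map_id.symm)

/-- The law of the coalescence state is stationary. -/
lemma hasLaw_stationary (hX : IsLevyInput b X P) (hQ : IsTransient Q) (hb : 0 ≤ b)
    (hout : ∀ᵐ ω ∂P, ∀ y, ∀ᶠ t in atTop,
      skState Q (revPath (fun u => X u ω) t) y t = out ω) (T : ℝ≥0) :
    HasLaw (fun p : Ω × (Fin d → ℝ) => skState Q (fun u => X u p.1) p.2 T) (P.map out)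
      (P.prod (P.map out)) := by
  have hm := hX.aemeasurable_limit hQ hb hout
  have hcast : Tendsto (fun n : ℕ => (n : ℝ≥0)) atTop atTop := tendsto_natCast_atTop_atTop
  have h1 : IdentDistrib (fun p : Ω × Ω => skState Q (fun u => X u p.1) (out p.2) T) out
      (P.prod P) P := by
    -- Stage `n` is the Markov property at times `n` and `n + T`, with both sides rewritten through
    -- reversed paths. Both sequences are eventually constant, so no continuity in the initial state
    -- is needed.
    refine identDistrib_of_tendsto
      (A := fun (n : ℕ) p => skState Q (fun u => X u p.1)
        (skState Q (revPath (fun u => X u p.2) n) 0 n) T)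
      (A' := fun (n : ℕ) ω => skState Q (revPath (fun u => X u ω) (n + T)) 0 (n + T))
      (fun n => ?_) ?_ ?_
    · have h2 := hX.identDistrib_rev_const hQ hb 0 (n : ℝ≥0)
      have h3 := hX.identDistrib_prod_map hQ hb h2.aemeasurable_snd T
      rw [← h2.map_eq] at h3
      exact (h3.trans (hX.identDistrib_add hQ hb 0 n T).symm).trans
        (hX.identDistrib_rev_const hQ hb 0 (n + T))
    · filter_upwards [(measurePreserving_snd (μ := P) (ν := P)).quasiMeasurePreserving.ae hout]
        with p hp
      refine tendsto_const_nhds.congr' ?_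
      filter_upwards [hcast.eventually (hp 0)] with n hn
      rw [hn]
    · filter_upwards [hout] with ω hω
      refine tendsto_const_nhds.congr' ?_
      filter_upwards [(tendsto_atTop_mono (fun n : ℕ => (le_self_add : (n : ℝ≥0) ≤ n + T))
        hcast).eventually (hω 0)] with n hn
      rw [hn]
  exact (h1.symm.trans (hX.identDistrib_prod_map hQ hb hm T)).hasLaw ⟨hm, rfl⟩

end IsLevyInput

end Levy


/-! ### The workload of the network -/

section Workload

variable {Ω : Type*} {d : ℕ} {lam : ℝ≥0} {N : ℝ≥0 → Ω → ℕ} {W : ℕ → Ω → (Fin d → ℝ)}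
  {Q : Matrix (Fin d) (Fin d) ℝ} {r z : Fin d → ℝ} {b : Fin d → ℝ} {X : ℝ≥0 → Ω → Fin d → ℝ}

/-- The drift `z` cancels: it serves to find `τ`, and the path reflected in Step 2 is the reversal
of `X` itself. -/
lemma reversedInput_dominatingInput (N : ℝ≥0 → Ω → ℕ) (W : ℕ → Ω → (Fin d → ℝ))
    (Q : Matrix (Fin d) (Fin d) ℝ) (r z : Fin d → ℝ) (τ : ℝ≥0) (ω : Ω) :
    reversedInput (fun u => dominatingInput N W Q r z u ω) z τ
      = revPath (fun u => netInput N W Q r u ω) τ := by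
  funext t
  simp only [reversedInput, dominatingInput, revPath]
  abel

variable [MeasurableSpace Ω] {P : Measure Ω}

/-- The output of the algorithm is the state of the reversed reflection. -/
lemma IsGoodPath.isOutput_iff {ω : Ω} (h : IsGoodPath N W Q r z ω) (hN : IsPoissonProcess lam N P)
    (hQ : IsTransient Q) (τ : ℝ≥0) (y : Fin d → ℝ) :
    IsOutput (reflMatrix Q) (fun u => dominatingInput N W Q r z u ω) z τ y
      ↔ y = skState Q (revPath (fun u => netInput N W Q r u ω) τ) 0 τ := by
  have hb := drainRate_nonneg Q r
  have hx := (isInputPath_netInput (Q := Q) (r := r) hN h.nonneg).rev hb τ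
  rw [IsOutput, reversedInput_dominatingInput]
  constructor
  · rintro ⟨Y, L, hYL, rfl⟩
    exact hYL.eq_skState hQ hx le_rfl
  · rintro rfl
    obtain ⟨L, hL⟩ := hx.exists_isSkorokhodSolution hQ hb (le_refl 0)
    exact ⟨_, L, hL τ, rfl⟩

/-- The reversed reflections, from any initial state, coalesce at a record time. -/
lemma IsGoodPath.eventually_skState_revPath_eq {ω : Ω} (h : IsGoodPath N W Q r z ω)
    (hN : IsPoissonProcess lam N P) (hQ : IsTransient Q) (hz : ∀ i, ((reflMatrix Q)⁻¹ *ᵥ z) i < 0)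
    {τ : ℝ≥0} (hτ : ∀ u, τ ≤ u → dominatingInput N W Q r z u ω ≤ dominatingInput N W Q r z τ ω)
    (y : Fin d → ℝ) :
    ∀ᶠ t in atTop, skState Q (revPath (fun u => netInput N W Q r u ω) t) y t
      = skState Q (revPath (fun u => netInput N W Q r u ω) τ) 0 τ := by
  have hx := isInputPath_netInput (Q := Q) (r := r) hN h.nonneg
  have hfar : ∀ᶠ t in atTop, ∀ i,
      dominatingInput N W Q r z t ω i ≤ dominatingInput N W Q r z τ ω i - y i :=
    eventually_all.2 fun i => (h.tendsto i).eventually_le_atBot _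
  filter_upwards [hfar, eventually_ge_atTop τ] with t ht hτt
  refine hx.skState_revPath_eq hQ (drainRate_nonneg Q r) hz hτt hτ fun i => ?_
  have := ht i
  simp only [dominatingInput, Pi.add_apply, Pi.sub_apply] at this ⊢
  linarith

lemma ae_eq_skState {ν : Measure (Fin d → ℝ)} [IsProbabilityMeasure ν] (hQ : IsTransient Q)
    (hX : IsLevyInput b X P) {Y : ℝ≥0 → Ω × (Fin d → ℝ) → (Fin d → ℝ)}
    (hY : IsWorkload P (reflMatrix Q) X ν Y) (t : ℝ≥0) :
    (fun p : Ω × (Fin d → ℝ) => skState Q (fun u => X u p.1) p.2 t) =ᵐ[P.prod ν] Y t := by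
  filter_upwards [hY,
    (measurePreserving_fst (μ := P) (ν := ν)).quasiMeasurePreserving.ae hX.path] with p hp hx
  obtain ⟨L, hL⟩ := hp
  exact ((hL t).eq_skState hQ hx le_rfl).symm

variable [IsProbabilityMeasure P]

lemma isLevyInput_netInput (hN : IsPoissonProcess lam N P)
    (hW : IsJobSequence W P) (hWN : IndepFun (fun ω k => W k ω) (fun ω t => N t ω) P) (Q : Matrix (Fin d) (Fin d) ℝ)
    (r : Fin d → ℝ) : IsLevyInput (drainRate Q r) (netInput N W Q r) P where
  measurable t := (measurable_arrivedWork hN hW t).sub_const _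
  indepIncrements := by
    intro n t ht
    have h := (arrivedWork_hasIndepIncrements hN hW hWN n t ht).comp
      (fun i v => v - ((t i.succ : ℝ) - t i.castSucc) • (reflMatrix Q *ᵥ r))
      (fun i => measurable_id.sub_const _)
    convert h using 1
    funext i
    funext ω
    simp only [netInput, Function.comp_apply, sub_smul]
    abel
  identDistrib s t s' t' hst hst' h := by
    have hr : ((t : ℝ) - s) = (t' : ℝ) - s' := by
      rw [← NNReal.coe_sub hst, ← NNReal.coe_sub hst', h]
    have h1 := (arrivedWork_identDistrib_sub hN hW hWN hst hst' h).comp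
      (u := fun v => v - ((t : ℝ) - s) • (reflMatrix Q *ᵥ r)) (measurable_id.sub_const _)
    convert h1 using 1
    · funext ω
      simp only [netInput, Function.comp_apply, sub_smul]
      abel
    · funext ω
      rw [hr]
      simp only [netInput, Function.comp_apply, sub_smul]
      abel
  path := (ae_all_iff.2 hW.nonneg).mono fun _ hω => isInputPath_netInput hN hω

lemma isWorkload_skState {ν : Measure (Fin d → ℝ)} [IsProbabilityMeasure ν] (hQ : IsTransient Q)
    (hb : 0 ≤ b) (hX : IsLevyInput b X P) (hν : ∀ᵐ y ∂ν, 0 ≤ y) :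
    IsWorkload P (reflMatrix Q) X ν fun t p => skState Q (fun u => X u p.1) p.2 t := by
  filter_upwards [(measurePreserving_snd (μ := P) (ν := ν)).quasiMeasurePreserving.ae hν,
    (measurePreserving_fst (μ := P) (ν := ν)).quasiMeasurePreserving.ae hX.path] with p hp hx
  exact hx.exists_isSkorokhodSolution hQ hb hp

end Workload

end ReflectedNetwork

theorem proposition2 {Ω : Type*} [MeasurableSpace Ω] (P : Measure Ω) [IsProbabilityMeasure P]
    {d : ℕ} (lam : ℝ≥0) (N : ℝ≥0 → Ω → ℕ) (W : ℕ → Ω → (Fin d → ℝ))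
    (hN : IsPoissonProcess lam N P) (hW : IsJobSequence W P)
    (hWN : IndepFun (fun ω k => W k ω) (fun ω t => N t ω) P)
    (Q : Matrix (Fin d) (Fin d) ℝ) (hQ : IsRoutingMatrix Q) (r : Fin d → ℝ)
    (hA1 : IsUnit (reflMatrix Q)) (hA1' : ∀ i j, 0 ≤ (reflMatrix Q)⁻¹ i j)
    (hA2 : ∀ i, ((reflMatrix Q)⁻¹ *ᵥ meanInput P N W Q r) i < 0)
    (hA3 : ∃ θ : Fin d → ℝ, (∀ i, 0 < θ i) ∧ Integrable (fun ω => Real.exp (θ ⬝ᵥ W 0 ω)) P)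
    (z : Fin d → ℝ) (hz : ∀ i, meanInput P N W Q r i < z i)
    (hz' : ∀ i, ((reflMatrix Q)⁻¹ *ᵥ z) i < 0) :
    -- the algorithm is well defined and terminates with probability one
    (∀ᵐ ω ∂P,
      (∀ t i, IsGreatest ((fun u => dominatingInput N W Q r z u ω i) '' Ici t)
        (futureMax (fun u => dominatingInput N W Q r z u ω) t i)) ∧
      (∃ τ, futureMax (fun u => dominatingInput N W Q r z u ω) τ
        = dominatingInput N W Q r z τ ω) ∧
      (∀ τ, futureMax (fun u => dominatingInput N W Q r z u ω) τ
          = dominatingInput N W Q r z τ ω →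
        ∃! y, IsOutput (reflMatrix Q) (fun u => dominatingInput N W Q r z u ω) z τ y)) ∧
    -- the law `π` of `Y(∞)`, and the output of the algorithm has law `π`
    ∃ (π : Measure (Fin d → ℝ)) (_ : IsProbabilityMeasure π),
      IsStationaryLaw P (reflMatrix Q) (netInput N W Q r) π ∧
      (∀ (ν : Measure (Fin d → ℝ)) [IsProbabilityMeasure ν],
        IsStationaryLaw P (reflMatrix Q) (netInput N W Q r) ν → ν = π) ∧
      (∀ (ν : Measure (Fin d → ℝ)) [IsProbabilityMeasure ν], (∀ᵐ y ∂ν, 0 ≤ y) →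
        (∃ Y, IsWorkload P (reflMatrix Q) (netInput N W Q r) ν Y) ∧
        ∀ Y, IsWorkload P (reflMatrix Q) (netInput N W Q r) ν Y →
          TendstoInDistribution Y atTop id (fun _ => P.prod ν) π) ∧
      (∀ (τ : Ω → ℝ≥0) (out : Ω → (Fin d → ℝ)),
        (∀ᵐ ω ∂P, futureMax (fun u => dominatingInput N W Q r z u ω) (τ ω)
            = dominatingInput N W Q r z (τ ω) ω ∧
          IsOutput (reflMatrix Q) (fun u => dominatingInput N W Q r z u ω) z (τ ω) (out ω)) →
        HasLaw out π P) := by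
  have hQT : IsTransient Q := ⟨hQ.nonneg, hA1, hA1'⟩
  have hb := drainRate_nonneg Q r
  have hX := isLevyInput_netInput hN hW hWN Q r
  have hgood := ae_isGoodPath hN hW hWN hA3 hz
  constructor
  · filter_upwards [hgood] with ω h
    refine ⟨h.isGreatest_futureMax hN, ?_, fun τ _ => ?_⟩
    · obtain ⟨τ, hτ⟩ := h.exists_record
      exact ⟨τ, (h.futureMax_eq_iff hN τ).2 hτ⟩
    · simp_rw [h.isOutput_iff hN hQT]
      exact existsUnique_eq
  -- An arbitrary choice of record times suffices, since coalescence makes `out` almost surely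
  -- independent of it.
  choose! ρ hρ using fun ω (h : IsGoodPath N W Q r z ω) => h.exists_record
  set out : Ω → Fin d → ℝ := fun ω =>
    skState Q (revPath (fun u => netInput N W Q r u ω) (ρ ω)) 0 (ρ ω)
  have hout : ∀ᵐ ω ∂P, ∀ y, ∀ᶠ t in atTop,
      skState Q (revPath (fun u => netInput N W Q r u ω) t) y t = out ω :=
    hgood.mono fun ω h => h.eventually_skState_revPath_eq hN hQT hz' (hρ ω h)
  have hm := hX.aemeasurable_limit hQT hb hout
  have hπ := Measure.isProbabilityMeasure_map hm
  have hconv : ∀ (ν : Measure (Fin d → ℝ)) [IsProbabilityMeasure ν] (Y),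
      IsWorkload P (reflMatrix Q) (netInput N W Q r) ν Y →
        TendstoInDistribution Y atTop id (fun _ => P.prod ν) (P.map out) := fun ν _ Y hY =>
    (hX.tendstoInDistribution hQT hb hout ν).congr (fun t => ae_eq_skState hQT hX hY t)
      (EventuallyEq.refl _ _)
  refine ⟨P.map out, hπ, ⟨_, isWorkload_skState hQT hb hX ?_,
    hX.hasLaw_stationary hQT hb hout⟩, ?_, fun ν _ hν => ⟨⟨_, isWorkload_skState hQT hb hX hν⟩,
    hconv ν⟩, ?_⟩
  · refine (ae_map_iff hm measurableSet_Ici).2 (hX.path.mono fun ω hω => ?_)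
    exact (hω.rev hb (ρ ω)).skState_nonneg hQT hb 0 (ρ ω)
  -- Under a stationary `ν` the law of `Y t` is constantly `ν` and converges to `π`.
  · rintro ν _ ⟨Y, hY, hlaw⟩
    have h1 : TendstoInDistribution (fun (_ : ℝ≥0) (y : Fin d → ℝ) => y) atTop id (fun _ => ν)
        (P.map out) :=
      tendstoInDistribution_of_map_eq (hconv ν Y hY) (fun _ => aemeasurable_id) aemeasurable_id
        (fun t => (hlaw t).map_eq.trans Measure.map_id.symm) rfl
    have h2 := tendstoInDistribution_unique _ (tendstoInDistribution_const aemeasurable_id) h1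
    rwa [Measure.map_id, Measure.map_id] at h2
  · intro τ out' h
    refine HasLaw.congr (X := out) ⟨hm, rfl⟩ ?_
    -- The output for any record time and `out` both equal the reversed state at some common large
    -- `t`, so they agree almost surely, even if `τ` is not measurable.
    filter_upwards [h, hgood, hout] with ω hω hg ho
    have h1 := (hg.isOutput_iff hN hQT _ _).1 hω.2
    have h2 := hg.eventually_skState_revPath_eq hN hQT hz' ((hg.futureMax_eq_iff hN _).1 hω.1) 0
    obtain ⟨t, ht, ht'⟩ := (h2.and (ho 0)).exists
    rw [h1, ← ht, ht']
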